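/- Let $\mathscr X\subset\mathbb R^n$ be compact, let $K:\mathscr X\times\mathscr X\to\mathbb R$ be a positive definite kernel (symmetric, with all matrices $[K(p_i,p_j)]$ positive semidefinite), let $\mathscr H_K$ be its reproducing kernel Hilbert space, and write $K_t=K(t,\cdot)\in\mathscr H_K$. On a probability space $(\Omega,\mathcal F,\mathbb P)$ let $y_k=f^\star(x_k)+v_k$, $k=0,1,2,\dots$, where $f^\star\in\mathscr H_K$ and $x_k:\Omega\to\mathscr X$, $y_k,v_k:\Omega\to\mathbb R$ are random variables. Let $\mathcal F_k$ be the $\sigma$-algebra generated by $K(t,x_i)$ ($t\in\mathscr X$) and $y_i$ for $0\le i\le k$, with $\mathcal F_{-1}$ trivial. For a metric space $(X,d)$ and $0\le s\le1$, let $\|f\|_{C^s(X)}=\sup_x|f(x)|+\sup_{x\ne y}|f(x)-f(y)|/d(x,y)^s$, let $C^s(X)$ be the space of continuous functions for which this is finite, and for a difference $\Delta$ of two Borel probability measures on $X$ let $\|\Delta\|_{(C^s(X))^*}=\sup\{|\int f\,\mathrm d\Delta|: f\in C^s(X),\ \|f\|_{C^s(X)}\le 1\}$. Suppose that: (a) $(v_k,\mathcal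 F_k)_k$ and $(v_kK_{x_k},\mathcal F_k)_k$ are martingale difference sequences, and there is $\beta>0$ such that $\mathbb E[v_k^2\mid\mathcal F_{k-1}]\le\beta$ almost surely for all $k\ge 0$; (b) there are $0\le s\le1$ and $\tau_s>0$ such that $K\in C^s(\mathscr X\times\mathscr X)$ and $|K(u_1,v_1)-K(u_2,v_1)-K(u_1,v_2)+K(u_2,v_2)|\le\tau_s\|u_1-u_2\|^s\|v_1-v_2\|^s$ for all $u_1,u_2,v_1,v_2\in\mathscr X$; (c) $a_k=(k+1)^{-\tau_1}$ and $\lambda_k=(k+1)^{-\tau_2}$ with $0.1<\tau_2<0.5<\tau_1<1$, $\tau_1+\tau_2<1$ and $3\tau_2<\tau_1$; (d) the pairs $(x_k,y_k)$, $k\ge0$, are mutually independent, and, with $\rho^{(k)}_{\mathscr X}$ denoting the distribution of $x_k$, there are an integer $h>0$ and a finite Borel measure $\gamma$ on $\mathscr X$, positive on every nonempty relatively open subset of $\mathscr X$, such that $\frac1h\sum_{i=k+1}^{k+h}\rho^{(i)}_{\mathscr X}\ge\gamma$ for all $k\ge0$; (e) $\|\rho^{(k+1)}_{\mathscr X}-\rho^{(k)}_{\mathscr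 X}\|_{(C^s(\mathscr X))^*}=O(a_k\lambda_k^2)$ as $k\to\infty$, with the same $s$ as in (b). Then for every $f_0\in\mathscr H_K$ the algorithm $f_{k+1}=f_k-a_k\big((f_k(x_k)-y_k)K_{x_k}+\lambda_kf_k\big)$, $k\ge0$, satisfies $f_k-f^\star\in L^2(\Omega;\mathscr H_K)$ for all $k$ and $\lim_{k\to\infty}\|f_k-f^\star\|^2_{L^2(\Omega;\mathscr H_K)}=0$. -/

import Mathlib

open MeasureTheory ProbabilityTheory Filter Topology
open scoped NNReal ENNReal

namespace OnlineRKHS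

noncomputable section

/-- A positive definite kernel: every matrix `[K (p i) (p j)]` is symmetric and positive
semidefinite. -/
def IsPosDefKernel {X : Type*} (K : X → X → ℝ) : Prop :=
  ∀ (m : ℕ) (p : Fin m → X), (Matrix.of fun i j => K (p i) (p j)).PosSemidef

/-! ### Hölder spaces and their duals -/

/-- The Hölder norm `‖f‖_{C^s} = sup |f| + sup_{x ≠ y} |f x - f y| / d(x, y) ^ s`, as an extended
nonnegative number. -/
def holderENorm {X : Type*} [PseudoMetricSpace X] (s : ℝ≥0) (f : X → ℝ) : ℝ≥0∞ :=
  (⨆ x, ‖f x‖ₑ) + eHolderNorm s f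

/-- Membership in `C^s`: continuous functions of finite Hölder norm. Continuity only has to be
required separately because `s = 0` is allowed. -/
def MemHolderSpace {X : Type*} [PseudoMetricSpace X] (s : ℝ≥0) (f : X → ℝ) : Prop :=
  Continuous f ∧ holderENorm s f < ∞

/-- The norm `‖ρ - ρ'‖` in the dual of `C^s`, where `ρ - ρ'` acts by `f ↦ ∫ f dρ - ∫ f dρ'`:
the supremum of `|∫ f dρ - ∫ f dρ'|` over the unit ball of `C^s`. -/
def holderDualENorm {X : Type*} [PseudoMetricSpace X] [MeasurableSpace X] (s : ℝ≥0)
    (ρ ρ' : Measure X) : ℝ≥0∞ :=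
  ⨆ (f : X → ℝ) (_ : MemHolderSpace s f) (_ : holderENorm s f ≤ 1),
    ‖(∫ t, f t ∂ρ) - ∫ t, f t ∂ρ'‖ₑ

/-- The kernel condition of order `s` with constant `τ`: `K` is of class `C^s` on `X × X` and its
mixed second differences are bounded by `τ d(u₁, u₂)^s d(v₁, v₂)^s`. -/
def HolderKernelCondition {X : Type*} [PseudoMetricSpace X] (s : ℝ≥0) (τ : ℝ)
    (K : X → X → ℝ) : Prop :=
  MemHolderSpace s (fun p : X × X => K p.1 p.2) ∧
    ∀ u₁ u₂ v₁ v₂ : X, |K u₁ v₁ - K u₂ v₁ - K u₁ v₂ + K u₂ v₂|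
      ≤ τ * dist u₁ u₂ ^ (s : ℝ) * dist v₁ v₂ ^ (s : ℝ)

/-! ### The data, the noise and the algorithm -/

/-- `pastSigma K x y k` is the `σ`-algebra `ℱ_{k-1}` generated by `K (t, x_i)`, `t ∈ X`, and `y_i`
for `i < k`; so `pastSigma K x y 0` is trivial and `ℱ_k` is `pastSigma K x y (k + 1)`. -/
@[reducible] def pastSigma {X Ω : Type*} (K : X → X → ℝ) (x : ℕ → Ω → X) (y : ℕ → Ω → ℝ) (k : ℕ) :
    MeasurableSpace Ω :=
  ⨆ (i : ℕ) (_ : i < k),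
    (⨆ t : X, MeasurableSpace.comap (fun ω => K t (x i ω)) (borel ℝ)) ⊔
      MeasurableSpace.comap (y i) (borel ℝ)

theorem pastSigma_zero {X Ω : Type*} (K : X → X → ℝ) (x : ℕ → Ω → X) (y : ℕ → Ω → ℝ) :
    pastSigma K x y 0 = ⊥ := by
  simp [pastSigma]

theorem pastSigma_le {X Ω : Type*} [MeasurableSpace X] [mΩ : MeasurableSpace Ω]
    (K : X → X → ℝ) (hK : ∀ t, Measurable (K t)) (x : ℕ → Ω → X) (hx : ∀ k, Measurable (x k))
    (y : ℕ → Ω → ℝ) (hy : ∀ k, Measurable (y k)) (k : ℕ) : pastSigma K x y k ≤ mΩ := by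
  rw [pastSigma, ← BorelSpace.measurable_eq (α := ℝ)]
  exact iSup₂_le fun i _ => sup_le
    (iSup_le fun t => ((hK t).comp (hx i)).comap_le) (hy i).comap_le

/-- `u` is a martingale difference sequence with respect to `(ℱ_k)`, where `𝒢 k` stands for
`ℱ_{k-1}`. -/
def IsMartingaleDifference {Ω E : Type*} [MeasurableSpace Ω] [NormedAddCommGroup E]
    [NormedSpace ℝ E] [CompleteSpace E] (μ : Measure Ω) (𝒢 : ℕ → MeasurableSpace Ω)
    (u : ℕ → Ω → E) : Prop :=
  ∀ k, StronglyMeasurable[𝒢 (k + 1)] (u k) ∧ Integrable (u k) μ ∧ μ[u k | 𝒢 k] =ᵐ[μ] 0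

/-- The kernel section `K_t = K(t, ·)` as an element of the reproducing kernel Hilbert space. -/
def kerSection {X : Type*} (H : Type*) [NormedAddCommGroup H] [InnerProductSpace ℝ H]
    [CompleteSpace H] [RKHS ℝ H X ℝ] (t : X) : H :=
  RKHS.kerFun H t (1 : ℝ)

/-- The noise assumption: `(v_k)` and `(v_k K_{x_k})` are martingale difference sequences and the
conditional second moments of `v_k` given `ℱ_{k-1}` are bounded by a constant. Square
integrability of `v_k`, which is implied by this bound, is spelled out because Mathlib's
conditional expectation of a nonintegrable function is `0`. -/
def NoiseAssumption {X Ω : Type*} (H : Type*) [NormedAddCommGroup H] [InnerProductSpace ℝ H]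
    [CompleteSpace H] [RKHS ℝ H X ℝ] [MeasurableSpace Ω] (μ : Measure Ω)
    (𝒢 : ℕ → MeasurableSpace Ω) (x : ℕ → Ω → X) (v : ℕ → Ω → ℝ) : Prop :=
  IsMartingaleDifference μ 𝒢 v ∧
  IsMartingaleDifference μ 𝒢 (fun k ω => v k ω • kerSection H (x k ω)) ∧
  ∃ β : ℝ, 0 < β ∧ ∀ k, MemLp (v k) 2 μ ∧ ∀ᵐ ω ∂μ, (μ[fun ω' => v k ω' ^ 2 | 𝒢 k]) ω ≤ β

/-- The condition on the gains `a_k` and the regularization parameters `λ_k`. -/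
def GainCondition (a lam : ℕ → ℝ) : Prop :=
  ∃ τ₁ τ₂ : ℝ, 1 / 10 < τ₂ ∧ τ₂ < 1 / 2 ∧ 1 / 2 < τ₁ ∧ τ₁ < 1 ∧ τ₁ + τ₂ < 1 ∧ 3 * τ₂ < τ₁ ∧
    (∀ k : ℕ, a k = 1 / ((k : ℝ) + 1) ^ τ₁) ∧ ∀ k : ℕ, lam k = 1 / ((k : ℝ) + 1) ^ τ₂

/-- The online regularized algorithm
`f_{k+1} = f_k - a_k ((f_k(x_k) - y_k) K_{x_k} + λ_k f_k)` started at `f₀`. -/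
def estimate {X Ω H : Type*} [NormedAddCommGroup H] [InnerProductSpace ℝ H] [CompleteSpace H]
    [RKHS ℝ H X ℝ] (a lam : ℕ → ℝ) (x : ℕ → Ω → X) (y : ℕ → Ω → ℝ) (f₀ : H) : ℕ → Ω → H
  | 0 => fun _ => f₀
  | k + 1 => fun ω =>
      estimate a lam x y f₀ k ω -
        a k • (((estimate a lam x y f₀ k ω) (x k ω) - y k ω) • kerSection H (x k ω) +
          lam k • estimate a lam x y f₀ k ω)

end

end OnlineRKHS

namespace OnlineRKHS

/-! ### A recursive inequality -/

/-! Let `L_k = covOp H ρ_k`, with `ρ_k` the law of `x_k`, and let `w_k` solve `(L_k + λ_k) w_k =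
-λ_k f*`. Then `f* + w_k` solves the Tikhonov equation for `ρ_k`, and `f_k - f*` splits into the
bias `w_k` and the deviation `δ_k = f_k - (f* + w_k)`.

Bias (`tendsto_norm_regularized`): the equation gives `‖w_k‖ ≤ ‖f*‖` and `⟪L_k w_k, w_k⟫ ≤ λ_k
‖f*‖²`. Since window averages dominate `γ` and the `L_k` drift slowly, `⟪L_γ w_k, w_k⟫ → 0`. As `γ`
charges every nonempty open set, `L_γ` is injective with dense range, so `w_k → 0` weakly. The
energy identity gives `‖w_k‖² ≤ -⟪f*, w_k⟫`, which makes the convergence strong.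

Deviation (`integral_norm_estimate_sub_sq_le`): one step contracts `δ_k` by `1 - a_k λ_k`, up to
`O(a_k²)` terms, and adds `a_k ξ_k` and `w_k - w_{k+1}`. The fluctuation `ξ_k` is centred and
independent of the past, so its first-order cross term vanishes in expectation. The path moves by
`o(a_k λ_k)`; this uses `w_k → 0` a second time. As `∑ a_k λ_k = ∞` and `a_k / λ_k → 0`, the
recursive inequality below gives `𝔼‖δ_k‖² → 0`. -/

theorem tendsto_zero_of_le_one_sub_mul_add {b α ε : ℕ → ℝ} (hb : ∀ k, 0 ≤ b k)
    (hα : ∀ᶠ k in atTop, 0 ≤ α k ∧ α k ≤ 1)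
    (hsum : Tendsto (fun n => ∑ i ∈ Finset.range n, α i) atTop atTop)
    (hε : Tendsto ε atTop (𝓝 0))
    (hrec : ∀ᶠ k in atTop, b (k + 1) ≤ (1 - α k) * b k + α k * ε k) :
    Tendsto b atTop (𝓝 0) := by
  refine tendsto_order.2 ⟨fun c hc => Eventually.of_forall fun k => hc.trans_le (hb k),
    fun δ hδ => ?_⟩
  obtain ⟨N, hN⟩ := eventually_atTop.1
    (hα.and (hrec.and (hε.eventually (gt_mem_nhds (half_pos hδ)))))
  -- Once `ε < δ / 2`, the excess of `b` over `δ / 2` contracts by `1 - α ≤ exp (-α)`.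
  have key : ∀ j, b (N + j) - δ / 2 ≤ Real.exp (-∑ i ∈ Finset.range j, α (N + i)) * b N := by
    intro j
    induction j with
    | zero => simp; linarith
    | succ j ih =>
      obtain ⟨⟨h0, h1⟩, hr, he⟩ := hN (N + j) (Nat.le_add_right _ _)
      have hexp := Real.one_sub_le_exp_neg (α (N + j))
      rw [Finset.sum_range_succ, neg_add, Real.exp_add, ← Nat.add_assoc]
      calc b (N + j + 1) - δ / 2 ≤ (1 - α (N + j)) * (b (N + j) - δ / 2) := by nlinarith
        _ ≤ (1 - α (N + j)) * (Real.exp (-∑ i ∈ Finset.range j, α (N + i)) * b N) :=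
            mul_le_mul_of_nonneg_left ih (by linarith)
        _ ≤ Real.exp (-α (N + j)) * (Real.exp (-∑ i ∈ Finset.range j, α (N + i)) * b N) :=
            mul_le_mul_of_nonneg_right hexp (mul_nonneg (Real.exp_pos _).le (hb N))
        _ = _ := by ring
  have hS : Tendsto (fun j => ∑ i ∈ Finset.range j, α (N + i)) atTop atTop := by
    have h1 : Tendsto (fun j => ∑ i ∈ Finset.range (N + j), α i) atTop atTop :=
      hsum.comp (tendsto_atTop_mono (fun j => Nat.le_add_left j N) tendsto_id)
    have h2 := tendsto_atTop_add_const_right _ (-∑ i ∈ Finset.range N, α i) h1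
    refine h2.congr fun j => ?_
    rw [Finset.sum_range_add]; ring
  have hlim : Tendsto (fun j => Real.exp (-∑ i ∈ Finset.range j, α (N + i)) * b N) atTop
      (𝓝 0) := by
    simpa using (Real.tendsto_exp_neg_atTop_nhds_zero.comp hS).mul_const (b N)
  obtain ⟨M, hM⟩ := eventually_atTop.1 (hlim.eventually (gt_mem_nhds (half_pos hδ)))
  filter_upwards [eventually_ge_atTop (N + M)] with k hk
  obtain ⟨j, rfl⟩ := Nat.exists_eq_add_of_le (le_of_add_le_left hk)
  have := key j
  have := hM j (by omega)
  linarith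

/-! ### The gains -/

theorem tendsto_nat_add_one_rpow_neg {p : ℝ} (hp : 0 < p) :
    Tendsto (fun k : ℕ => ((k : ℝ) + 1) ^ (-p)) atTop (𝓝 0) :=
  (tendsto_rpow_neg_atTop hp).comp
    (tendsto_atTop_add_const_right _ 1 tendsto_natCast_atTop_atTop)

theorem antitone_one_div_rpow {p : ℝ} (hp : 0 ≤ p) :
    Antitone fun k : ℕ => 1 / ((k : ℝ) + 1) ^ p := fun i j hij => by
  have : (i : ℝ) ≤ j := by exact_mod_cast hij
  dsimp only
  gcongr

namespace GainCondition

variable {a lam : ℕ → ℝ}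

theorem a_pos (h : GainCondition a lam) (k : ℕ) : 0 < a k := by
  obtain ⟨τ₁, τ₂, -, -, -, -, -, -, ha, -⟩ := h
  rw [ha]; positivity

theorem lam_pos (h : GainCondition a lam) (k : ℕ) : 0 < lam k := by
  obtain ⟨τ₁, τ₂, -, -, -, -, -, -, -, hl⟩ := h
  rw [hl]; positivity

theorem a_antitone (h : GainCondition a lam) : Antitone a := by
  obtain ⟨τ₁, τ₂, h1, h2, h3, h4, h5, h6, ha, hl⟩ := h
  rw [funext ha]; exact antitone_one_div_rpow (by linarith)

theorem lam_antitone (h : GainCondition a lam) : Antitone lam := by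
  obtain ⟨τ₁, τ₂, h1, h2, h3, h4, h5, h6, ha, hl⟩ := h
  rw [funext hl]; exact antitone_one_div_rpow (by linarith)

theorem lam_le_one (h : GainCondition a lam) (k : ℕ) : lam k ≤ 1 := by
  refine (h.lam_antitone (Nat.zero_le k)).trans ?_
  obtain ⟨τ₁, τ₂, h1, h2, h3, h4, h5, h6, ha, hl⟩ := h
  simp [hl]

theorem tendsto_a (h : GainCondition a lam) : Tendsto a atTop (𝓝 0) := by
  obtain ⟨τ₁, τ₂, h1, h2, h3, h4, h5, h6, ha, hl⟩ := h
  refine (tendsto_nat_add_one_rpow_neg (p := τ₁) (by linarith)).congr fun k => ?_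
  rw [ha, Real.rpow_neg (by positivity), one_div]

theorem tendsto_lam (h : GainCondition a lam) : Tendsto lam atTop (𝓝 0) := by
  obtain ⟨τ₁, τ₂, h1, h2, h3, h4, h5, h6, ha, hl⟩ := h
  refine (tendsto_nat_add_one_rpow_neg (p := τ₂) (by linarith)).congr fun k => ?_
  rw [hl, Real.rpow_neg (by positivity), one_div]

theorem tendsto_a_div_lam (h : GainCondition a lam) :
    Tendsto (fun k => a k / lam k) atTop (𝓝 0) := by
  obtain ⟨τ₁, τ₂, h1, h2, h3, h4, h5, h6, ha, hl⟩ := h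
  refine (tendsto_nat_add_one_rpow_neg (p := τ₁ - τ₂) (by linarith)).congr fun k => ?_
  have hk : (0 : ℝ) < (k : ℝ) + 1 := by positivity
  rw [ha, hl, neg_sub, Real.rpow_sub hk]
  field_simp

/-- Here `τ₁ + τ₂ < 1` makes the relative decrease of `λ_k`, at most `1 / (k + 1)`, negligible
against the contraction rate `a_k λ_k`. -/
theorem tendsto_inv_div_mul (h : GainCondition a lam) :
    Tendsto (fun k : ℕ => 1 / ((k : ℝ) + 1) / (a k * lam k)) atTop (𝓝 0) := by
  obtain ⟨τ₁, τ₂, h1, h2, h3, h4, h5, h6, ha, hl⟩ := h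
  refine (tendsto_nat_add_one_rpow_neg (p := 1 - (τ₁ + τ₂)) (by linarith)).congr fun k => ?_
  have hk : (0 : ℝ) < (k : ℝ) + 1 := by positivity
  rw [ha, hl, neg_sub, Real.rpow_sub hk, Real.rpow_add hk, Real.rpow_one]
  field_simp

theorem tendsto_sum_mul (h : GainCondition a lam) :
    Tendsto (fun n => ∑ i ∈ Finset.range n, a i * lam i) atTop atTop := by
  have h0 : ∀ k, 0 ≤ a k * lam k := fun k => (mul_pos (h.a_pos k) (h.lam_pos k)).le
  refine (not_summable_iff_tendsto_nat_atTop_of_nonneg h0).1 fun hs => ?_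
  obtain ⟨τ₁, τ₂, h1, h2, h3, h4, h5, h6, ha, hl⟩ := h
  have : 1 < τ₁ + τ₂ := by
    refine (Real.summable_one_div_nat_add_rpow 1 (τ₁ + τ₂)).1 (hs.congr fun k => ?_)
    have hk : (0 : ℝ) < (k : ℝ) + 1 := by positivity
    rw [abs_of_pos hk, ha, hl, Real.rpow_add hk]
    field_simp
  linarith

/-- Since `τ₂ ≤ 1`, the ratio `λ_{k+1} / λ_k = ((k+1)/(k+2)) ^ τ₂` is at least `(k+1)/(k+2)`. -/
theorem lam_sub_le (h : GainCondition a lam) (k : ℕ) :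
    lam k - lam (k + 1) ≤ 1 / ((k : ℝ) + 1) * lam k := by
  obtain ⟨τ₁, τ₂, h1, h2, h3, h4, h5, h6, ha, hl⟩ := h
  have hk : (0 : ℝ) < (k : ℝ) + 1 := by positivity
  have hk2 : (0 : ℝ) < (k : ℝ) + 2 := by positivity
  have hr : ((k : ℝ) + 1) / (k + 2) ≤ (((k : ℝ) + 1) / (k + 2)) ^ τ₂ := by
    refine Real.self_le_rpow_of_le_one (by positivity) ?_ (by linarith)
    rw [div_le_one hk2]; linarith
  have he : lam (k + 1) = (((k : ℝ) + 1) / (k + 2)) ^ τ₂ * lam k := by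
    have : ((k + 1 : ℕ) : ℝ) + 1 = (k : ℝ) + 2 := by push_cast; ring
    rw [hl, hl, this, Real.div_rpow hk.le hk2.le]
    have := Real.rpow_pos_of_pos hk τ₂
    field_simp
  have hlk : 0 < lam k := by rw [hl]; positivity
  have h1k : 1 - ((k : ℝ) + 1) / (k + 2) ≤ 1 / ((k : ℝ) + 1) := by
    rw [one_sub_div hk2.ne', div_le_div_iff₀ hk2 hk]; nlinarith
  rw [he]
  nlinarith

end GainCondition

/-! ### Cocoercive operators -/

section Cocoercive

variable {H : Type*} [NormedAddCommGroup H] [InnerProductSpace ℝ H]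

/-- `T` is cocoercive with constant `c`: `‖T f‖² ≤ c ⟪T f, f⟫`. -/
def IsCocoercive (c : ℝ) (T : H →L[ℝ] H) : Prop :=
  ∀ f, ‖T f‖ ^ 2 ≤ c * inner ℝ (T f) f

namespace IsCocoercive

variable {c : ℝ} {T : H →L[ℝ] H}

theorem inner_nonneg (hc : 0 < c) (hT : IsCocoercive c T) (f : H) : 0 ≤ inner ℝ (T f) f :=
  nonneg_of_mul_nonneg_right ((sq_nonneg _).trans (hT f)) hc

theorem norm_apply_le (hc : 0 < c) (hT : IsCocoercive c T) (f : H) : ‖T f‖ ≤ c * ‖f‖ := by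
  have h1 := hT f
  have h2 := real_inner_le_norm (T f) f
  by_contra! hlt
  have h3 : 0 < ‖T f‖ := (by positivity : 0 ≤ c * ‖f‖).trans_lt hlt
  nlinarith

/-- In the expanded square, cocoercivity bounds `a² ‖T f‖²` by `a² c ⟪T f, f⟫`; `hac` says exactly
that the cross term `-2a(1 - al) ⟪T f, f⟫` absorbs it. -/
theorem norm_sub_smul_le (hc : 0 < c) (hT : IsCocoercive c T) {a l : ℝ} (ha : 0 ≤ a)
    (hl1 : a * l ≤ 1) (hac : a * (c + 2 * l) ≤ 2) (f : H) :
    ‖f - a • (T f + l • f)‖ ≤ (1 - a * l) * ‖f‖ := by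
  have e : f - a • (T f + l • f) = (1 - a * l) • f - a • T f := by module
  refine le_of_sq_le_sq ?_ (mul_nonneg (by linarith) (norm_nonneg f))
  rw [e, norm_sub_sq_real, norm_smul, norm_smul, inner_smul_left, inner_smul_right,
    mul_pow, mul_pow, Real.norm_eq_abs, Real.norm_eq_abs, sq_abs, sq_abs, real_inner_comm]
  simp only [conj_trivial]
  have h1 := mul_le_mul_of_nonneg_left (hT f) (sq_nonneg a)
  have h2 := mul_nonneg (mul_nonneg ha (hT.inner_nonneg hc f)) (sub_nonneg.2 hac)
  nlinarith

/-- Neumann series: for `a = 1 / (c + 2l)` the operator `1 - a(T + l)` has norm at most `1 - al <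
1`. -/
theorem exists_regularized [CompleteSpace H] (hc : 0 < c) (hT : IsCocoercive c T) {l : ℝ}
    (hl : 0 < l) (g : H) : ∃ w, T w + l • w = g := by
  set a : ℝ := 1 / (c + 2 * l) with ha
  have ha0 : 0 < a := by positivity
  have hal : a * l ≤ 1 := by
    rw [ha, div_mul_eq_mul_div, one_mul, div_le_one (by positivity)]; linarith
  have hac : a * (c + 2 * l) ≤ 2 := by
    rw [ha, one_div, inv_mul_cancel₀ (by positivity)]; norm_num
  set S : H →L[ℝ] H := 1 - a • (T + l • 1) with hS
  have hSn : ‖S‖ < 1 := by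
    refine (S.opNorm_le_bound (by linarith : 0 ≤ 1 - a * l) fun f => ?_).trans_lt
      (sub_lt_self 1 (mul_pos ha0 hl))
    simpa [hS] using hT.norm_sub_smul_le hc ha0.le hal hac f
  obtain ⟨u, hu⟩ := isUnit_one_sub_of_norm_lt_one hSn
  have h1 : (1 - S) ((↑u⁻¹ : H →L[ℝ] H) (a • g)) = a • g := by
    rw [← hu, ← mul_apply_eq_comp, Units.mul_inv, one_apply_eq_self]
  refine ⟨(↑u⁻¹ : H →L[ℝ] H) (a • g), smul_right_injective H ha0.ne' ?_⟩
  simpa [hS, smul_comm l a] using h1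

theorem norm_mul_le_norm_add (hc : 0 < c) (hT : IsCocoercive c T) {l : ℝ} (w : H) :
    l * ‖w‖ ≤ ‖T w + l • w‖ := by
  rcases (norm_nonneg w).eq_or_lt with h0 | h0
  · rw [← h0]; simp
  have h1 := real_inner_le_norm (T w + l • w) w
  rw [inner_add_left, inner_smul_left, real_inner_self_eq_norm_sq] at h1
  simp only [conj_trivial] at h1
  have h2 := hT.inner_nonneg hc w
  refine le_of_mul_le_mul_right ?_ h0
  nlinarith

/-- The hypothesis `hw` is equivalent to `(T + l)(f + w) = T f`, so `w` is the bias of Tikhonov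
regularization with target `f`. -/
theorem norm_regularized_le (hc : 0 < c) (hT : IsCocoercive c T) {l : ℝ} (hl : 0 < l) {w f : H}
    (hw : T w + l • w = -(l • f)) : ‖w‖ ≤ ‖f‖ := by
  have := hT.norm_mul_le_norm_add hc (l := l) w
  rw [hw, norm_neg, norm_smul, Real.norm_of_nonneg hl.le] at this
  exact le_of_mul_le_mul_left this hl

theorem inner_add_sq_regularized {l : ℝ} {w f : H} (hw : T w + l • w = -(l • f)) :
    inner ℝ (T w) w + l * ‖w‖ ^ 2 = -(l * inner ℝ f w) := by
  have := congrArg (fun z => inner ℝ z w) hw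
  simpa [inner_add_left, inner_smul_left, inner_neg_left] using this

theorem inner_regularized_le (hc : 0 < c) (hT : IsCocoercive c T) {l : ℝ} (hl : 0 < l) {w f : H}
    (hw : T w + l • w = -(l • f)) : inner ℝ (T w) w ≤ l * ‖f‖ ^ 2 := by
  have h1 := inner_add_sq_regularized hw
  have h2 := hT.norm_regularized_le hc hl hw
  have h3 := neg_le_of_abs_le (abs_real_inner_le_norm f w)
  have h4 : -(inner ℝ f w) ≤ ‖f‖ ^ 2 := by nlinarith [norm_nonneg f]
  nlinarith [mul_le_mul_of_nonneg_left h4 hl.le, sq_nonneg ‖w‖, mul_nonneg hl.le (sq_nonneg ‖w‖)]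

/-- Subtract the two equations and use coercivity of `T + l`. The operator perturbation multiplies
`‖w'‖` rather than `‖f‖`, which matters because the biases tend to zero. -/
theorem norm_regularized_sub_le {T' : H →L[ℝ] H} (hc : 0 < c) (hT : IsCocoercive c T)
    {l l' : ℝ} {w w' f : H} (hw : T w + l • w = -(l • f)) (hw' : T' w' + l' • w' = -(l' • f)) :
    l * ‖w' - w‖ ≤ ‖T' - T‖ * ‖w'‖ + |l - l'| * (‖w'‖ + ‖f‖) := by
  refine (hT.norm_mul_le_norm_add hc (w' - w)).trans ?_
  have e : T (w' - w) + l • (w' - w) = -((T' - T) w') + (l - l') • (w' + f) := by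
    have : T (w' - w) + l • (w' - w) = T w' + l • w' - (T w + l • w) := by
      rw [map_sub]; module
    rw [this, hw, sub_apply, eq_sub_of_add_eq hw']; module
  rw [e]
  refine (norm_add_le _ _).trans (add_le_add ?_ ?_)
  · rw [norm_neg]; exact (T' - T).le_opNorm w'
  · rw [norm_smul, Real.norm_eq_abs]
    exact mul_le_mul_of_nonneg_left (norm_add_le _ _) (abs_nonneg _)

end IsCocoercive

end Cocoercive

/-! ### Weak convergence from a vanishing quadratic form -/

namespace IsCocoercive

variable {H : Type*} [NormedAddCommGroup H] [InnerProductSpace ℝ H] {c : ℝ} {T : H →L[ℝ] H}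

/-- A vector `g` orthogonal to the range is orthogonal to `T g`, hence zero. -/
theorem denseRange_of_inner_eq_zero [CompleteSpace H]
    (hinj : ∀ f, inner ℝ (T f) f = 0 → f = 0) : DenseRange T := by
  have h1 : T.range.topologicalClosure = ⊤ := by
    rw [Submodule.topologicalClosure_eq_top_iff, Submodule.eq_bot_iff]
    exact fun g hg => hinj g (hg (T g) ⟨g, rfl⟩)
  exact Submodule.dense_iff_topologicalClosure_eq_top.2 h1

/-- Cocoercivity turns vanishing energy into `T w_k → 0`. By symmetry `⟪T g, w_k⟫ = ⟪g, T w_k⟫ → 0`;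
density of the range and boundedness of `w_k` extend this to every `f`. -/
theorem tendsto_inner_of_tendsto_inner_apply [CompleteSpace H] (hT : IsCocoercive c T)
    (hsymm : ∀ f g, inner ℝ (T f) g = inner ℝ f (T g))
    (hinj : ∀ f, inner ℝ (T f) f = 0 → f = 0) {w : ℕ → H} {F : ℝ} (hF : ∀ k, ‖w k‖ ≤ F)
    (hw : Tendsto (fun k => inner ℝ (T (w k)) (w k)) atTop (𝓝 0)) (f : H) :
    Tendsto (fun k => inner ℝ f (w k)) atTop (𝓝 0) := by
  have hTw : Tendsto (fun k => ‖T (w k)‖) atTop (𝓝 0) := by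
    have h1 : Tendsto (fun k => ‖T (w k)‖ ^ 2) atTop (𝓝 0) :=
      squeeze_zero (fun k => sq_nonneg _) (fun k => hT (w k)) (by simpa using hw.const_mul c)
    simpa using h1.sqrt
  have hF0 : 0 ≤ F := (norm_nonneg _).trans (hF 0)
  refine Metric.tendsto_atTop'.2 fun ε hε => ?_
  obtain ⟨g, hg⟩ := Metric.denseRange_iff.1 (denseRange_of_inner_eq_zero hinj) f
    (ε / (2 * (F + 1))) (by positivity)
  have h2 : Tendsto (fun k => ‖g‖ * ‖T (w k)‖) atTop (𝓝 0) := by simpa using hTw.const_mul ‖g‖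
  obtain ⟨N, hN⟩ := eventually_atTop.1 (h2.eventually (gt_mem_nhds (half_pos hε)))
  refine ⟨N, fun k hk => ?_⟩
  have e : inner ℝ f (w k) = inner ℝ (f - T g) (w k) + inner ℝ g (T (w k)) := by
    rw [inner_sub_left, hsymm]; ring
  rw [dist_zero_right, e]
  have h3 : ‖inner ℝ (f - T g) (w k)‖ ≤ ε / 2 := by
    refine (norm_inner_le_norm _ _).trans ?_
    rw [dist_eq_norm] at hg
    calc ‖f - T g‖ * ‖w k‖ ≤ ε / (2 * (F + 1)) * (F + 1) :=
          mul_le_mul hg.le ((hF k).trans (by linarith)) (norm_nonneg _) (by positivity)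
      _ = ε / 2 := by field_simp
  have h4 : ‖inner ℝ g (T (w k))‖ < ε / 2 := (norm_inner_le_norm _ _).trans_lt (hN k hk.le)
  linarith [norm_add_le (inner ℝ (f - T g) (w k)) (inner ℝ g (T (w k)))]

end IsCocoercive

/-! ### Kernel sections and covariance operators -/

section Kernel

variable {X : Type*} {H : Type*} [NormedAddCommGroup H] [InnerProductSpace ℝ H]
  [CompleteSpace H] [RKHS ℝ H X ℝ]

theorem inner_kerSection (f : H) (t : X) : inner ℝ f (kerSection H t) = f t := by
  simp [kerSection]

theorem kerSection_inner (f : H) (t : X) : inner ℝ (kerSection H t) f = f t := by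
  simp [kerSection]

theorem norm_kerSection_sub_sq {K : X → X → ℝ} (hH : ∀ t u : X, RKHS.kernel H t u (1 : ℝ) = K t u)
    (u v : X) : ‖kerSection H u - kerSection H v‖ ^ 2 = K u u - K v u - K u v + K v v := by
  have hK : ∀ t u, inner ℝ (kerSection H u) (kerSection H t) = K t u := fun t u => by
    rw [inner_kerSection, kerSection, RKHS.kerFun_apply, hH]
  rw [← real_inner_self_eq_norm_sq, inner_sub_left, inner_sub_right, inner_sub_right, hK, hK, hK,
    hK]
  ring

/-- Continuity comes from that of `K`, because the Hölder bound gives none when `s = 0`. -/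
theorem continuous_kerSection [TopologicalSpace X] {K : X → X → ℝ}
    (hH : ∀ t u : X, RKHS.kernel H t u (1 : ℝ) = K t u)
    (hK : Continuous fun p : X × X => K p.1 p.2) : Continuous (kerSection H : X → H) := by
  refine continuous_iff_continuousAt.2 fun v => tendsto_iff_norm_sub_tendsto_zero.2 ?_
  have h1 : Continuous fun u => K u u - K v u - K u v + K v v := by
    have := fun f g (hf : Continuous f) (hg : Continuous g) =>
      hK.comp (hf.prodMk hg : Continuous fun u : X => (f u, g u))
    exact (((this _ _ continuous_id continuous_id).sub
      (this _ _ continuous_const continuous_id)).sub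
      (this _ _ continuous_id continuous_const)).add continuous_const
  have h2 := (h1.tendsto v).sqrt
  simp only [sub_self, zero_sub, neg_add_cancel, Real.sqrt_zero] at h2
  refine h2.congr fun u => ?_
  rw [← norm_kerSection_sub_sq hH, Real.sqrt_sq (norm_nonneg _)]

theorem continuous_coe [TopologicalSpace X] (hφ : Continuous (kerSection H : X → H)) (f : H) :
    Continuous f := by
  simp_rw [show (f : X → ℝ) = fun t => inner ℝ f (kerSection H t) from
    funext fun t => (inner_kerSection f t).symm]
  fun_prop

theorem abs_apply_sq_le {κ : ℝ} (hκ : ∀ t : X, ‖kerSection H t‖ ^ 2 ≤ κ) (f : H) (t : X) :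
    f t ^ 2 ≤ κ * ‖f‖ ^ 2 := by
  have h1 := norm_inner_le_norm (𝕜 := ℝ) f (kerSection H t)
  rw [inner_kerSection, Real.norm_eq_abs] at h1
  calc f t ^ 2 = |f t| ^ 2 := (sq_abs _).symm
    _ ≤ (‖f‖ * ‖kerSection H t‖) ^ 2 := pow_le_pow_left₀ (abs_nonneg _) h1 2
    _ = ‖kerSection H t‖ ^ 2 * ‖f‖ ^ 2 := by ring
    _ ≤ _ := mul_le_mul_of_nonneg_right (hκ t) (sq_nonneg _)

variable (H) in
/-- The rank one operator `f ↦ f(t) K_t`. -/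
noncomputable def evalOp (t : X) : H →L[ℝ] H :=
  ContinuousLinearMap.smulRightL ℝ H H (innerSL ℝ (kerSection H t)) (kerSection H t)

theorem evalOp_apply (t : X) (f : H) : evalOp H t f = f t • kerSection H t := by
  change inner ℝ (kerSection H t) f • kerSection H t = _
  rw [kerSection_inner]

theorem isCocoercive_evalOp {κ : ℝ} (hκ : ∀ t : X, ‖kerSection H t‖ ^ 2 ≤ κ) (t : X) :
    IsCocoercive κ (evalOp H t) := fun f => by
  rw [evalOp_apply, norm_smul, mul_pow, Real.norm_eq_abs, sq_abs, inner_smul_left,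
    kerSection_inner]
  simp only [conj_trivial]
  nlinarith [mul_le_mul_of_nonneg_left (hκ t) (sq_nonneg (f t))]

theorem continuous_evalOp [TopologicalSpace X] (hφ : Continuous (kerSection H : X → H)) :
    Continuous (evalOp H : X → H →L[ℝ] H) :=
  ((ContinuousLinearMap.smulRightL ℝ H H).continuous.comp
    ((innerSL ℝ).continuous.comp hφ)).clm_apply hφ

variable [TopologicalSpace X] [CompactSpace X] [MeasurableSpace X] [BorelSpace X]

variable (H) in
/-- The covariance operator `f ↦ ∫ f(t) K_t dρ(t)`. -/
noncomputable def covOp (ρ : Measure X) : H →L[ℝ] H := ∫ t, evalOp H t ∂ρ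

theorem integrable_of_continuous {E : Type*} [NormedAddCommGroup E] (ρ : Measure X)
    [IsFiniteMeasure ρ] {f : X → E} (hf : Continuous f) : Integrable f ρ :=
  hf.integrable_of_hasCompactSupport (HasCompactSupport.of_compactSpace f)

theorem covOp_apply (hφ : Continuous (kerSection H : X → H)) (ρ : Measure X) [IsFiniteMeasure ρ]
    (f : H) : covOp H ρ f = ∫ t, evalOp H t f ∂ρ :=
  ContinuousLinearMap.integral_apply (integrable_of_continuous ρ (continuous_evalOp hφ)) f

theorem inner_covOp (hφ : Continuous (kerSection H : X → H)) (ρ : Measure X) [IsFiniteMeasure ρ]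
    (f g : H) : inner ℝ (covOp H ρ f) g = ∫ t, f t * g t ∂ρ := by
  rw [covOp_apply hφ, real_inner_comm, ← integral_inner
    (integrable_of_continuous ρ ((continuous_evalOp hφ).clm_apply continuous_const))]
  refine integral_congr_ae (Eventually.of_forall fun t => ?_)
  simp only [evalOp_apply, inner_smul_right, inner_kerSection]

theorem inner_covOp_comm (hφ : Continuous (kerSection H : X → H)) (ρ : Measure X)
    [IsFiniteMeasure ρ] (f g : H) : inner ℝ (covOp H ρ f) g = inner ℝ f (covOp H ρ g) := by
  rw [real_inner_comm _ f, inner_covOp hφ, inner_covOp hφ]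
  simp_rw [mul_comm]

/-- With `g = L f`, `‖g‖² = ∫ f g dρ`. Young's inequality bounds this by `(c/2) ∫ f² + (1/2c) ∫ g²`,
and `∫ g² ≤ c ‖g‖²` lets half of `‖g‖²` be absorbed. -/
theorem isCocoercive_covOp (hφ : Continuous (kerSection H : X → H)) {κ : ℝ}
    (hκ : ∀ t : X, ‖kerSection H t‖ ^ 2 ≤ κ) (ρ : Measure X) [IsFiniteMeasure ρ] {c : ℝ}
    (hc : 0 < c) (hκc : κ * ρ.real Set.univ ≤ c) : IsCocoercive c (covOp H ρ) := fun f => by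
  set g := covOp H ρ f with hg
  have hf2 : Continuous fun t => f t ^ 2 := (continuous_coe hφ f).pow 2
  have hg2 : Continuous fun t => g t ^ 2 := (continuous_coe hφ g).pow 2
  have h1 : ‖g‖ ^ 2 = ∫ t, f t * g t ∂ρ := by
    rw [← real_inner_self_eq_norm_sq, ← inner_covOp hφ]
  have h2 : inner ℝ g f = ∫ t, f t ^ 2 ∂ρ := by
    rw [hg, inner_covOp hφ]; simp_rw [sq]
  have h3 : ∫ t, g t ^ 2 ∂ρ ≤ c * ‖g‖ ^ 2 := by
    calc ∫ t, g t ^ 2 ∂ρ ≤ ∫ _, κ * ‖g‖ ^ 2 ∂ρ :=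
          integral_mono (integrable_of_continuous ρ hg2) (integrable_const _)
            (abs_apply_sq_le hκ g)
      _ = (κ * ρ.real Set.univ) * ‖g‖ ^ 2 := by rw [integral_const, smul_eq_mul]; ring
      _ ≤ _ := mul_le_mul_of_nonneg_right hκc (sq_nonneg _)
  have h4 : ∫ t, f t * g t ∂ρ ≤ ∫ t, (c / 2 * f t ^ 2 + 1 / (2 * c) * g t ^ 2) ∂ρ := by
    refine integral_mono (integrable_of_continuous ρ ((continuous_coe hφ f).mul
      (continuous_coe hφ g))) (((integrable_of_continuous ρ hf2).const_mul _).add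
      ((integrable_of_continuous ρ hg2).const_mul _)) fun t => ?_
    have e : c / 2 * f t ^ 2 + 1 / (2 * c) * g t ^ 2 - f t * g t
        = (c * f t - g t) ^ 2 / (2 * c) := by field_simp; ring
    have : 0 ≤ (c * f t - g t) ^ 2 / (2 * c) := by positivity
    dsimp only
    linarith
  rw [integral_add ((integrable_of_continuous ρ hf2).const_mul _)
    ((integrable_of_continuous ρ hg2).const_mul _), integral_const_mul, integral_const_mul,
    ← h1, ← h2] at h4
  have h5 : 1 / (2 * c) * ∫ t, g t ^ 2 ∂ρ ≤ ‖g‖ ^ 2 / 2 := by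
    refine (mul_le_mul_of_nonneg_left h3 (by positivity)).trans_eq ?_
    field_simp
  linarith

theorem eq_zero_of_inner_covOp_eq_zero (hφ : Continuous (kerSection H : X → H)) (ρ : Measure X)
    [IsFiniteMeasure ρ] [ρ.IsOpenPosMeasure] (f : H) (hf : inner ℝ (covOp H ρ f) f = 0) :
    f = 0 := by
  have hc := (continuous_coe hφ f)
  rw [inner_covOp hφ, integral_eq_zero_iff_of_nonneg (fun t => mul_self_nonneg (f t))
    (integrable_of_continuous ρ (hc.mul hc))] at hf
  have h0 := (Continuous.ae_eq_iff_eq ρ (hc.mul hc) continuous_zero).1 hf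
  ext t
  simpa using congrFun h0 t

/-- The form `⟪covOp H ρ f, f⟫ = ∫ f² dρ` is monotone in `ρ`; replacing each operator of the window
by that of `ρ k` costs at most `E ‖f‖²`. -/
theorem inner_covOp_le_of_window (hφ : Continuous (kerSection H : X → H)) {ρ : ℕ → Measure X}
    [∀ i, IsFiniteMeasure (ρ i)] {γ : Measure X} [IsFiniteMeasure γ] {h k : ℕ} (hh : 0 < h)
    (hγ : γ ≤ (h : ℝ≥0∞)⁻¹ • ∑ i ∈ Finset.Icc (k + 1) (k + h), ρ i) {E : ℝ}
    (hE : ∀ i ∈ Finset.Icc (k + 1) (k + h), ‖covOp H (ρ i) - covOp H (ρ k)‖ ≤ E) (f : H) :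
    inner ℝ (covOp H γ f) f ≤ inner ℝ (covOp H (ρ k) f) f + E * ‖f‖ ^ 2 := by
  have hh' : (0 : ℝ) < h := by exact_mod_cast hh
  have hcont := (continuous_coe hφ f).mul (continuous_coe hφ f)
  have hint : ∀ i, Integrable (fun t => f t * f t) (ρ i) := fun i =>
    integrable_of_continuous (ρ i) hcont
  have h1 : inner ℝ (covOp H γ f) f ≤
      (h : ℝ)⁻¹ * ∑ i ∈ Finset.Icc (k + 1) (k + h), inner ℝ (covOp H (ρ i) f) f := by
    simp_rw [inner_covOp hφ]
    refine (integral_mono_measure hγ (Eventually.of_forall fun t => mul_self_nonneg (f t))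
      ((integrable_finsetSum_measure.2 fun i _ => hint i).smul_measure
        (ENNReal.inv_ne_top.2 (by simpa using hh.ne')))).trans_eq ?_
    rw [integral_smul_measure, integral_finsetSum_measure fun i _ => hint i]
    simp
  have h2 : ∀ i ∈ Finset.Icc (k + 1) (k + h), inner ℝ (covOp H (ρ i) f) f ≤
      inner ℝ (covOp H (ρ k) f) f + E * ‖f‖ ^ 2 := fun i hi => by
    have h3 := real_inner_le_norm ((covOp H (ρ i) - covOp H (ρ k)) f) f
    rw [sub_apply, inner_sub_left] at h3
    have h4 := ((covOp H (ρ i) - covOp H (ρ k)).le_opNorm f).trans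
      (mul_le_mul_of_nonneg_right (hE i hi) (norm_nonneg f))
    rw [sub_apply] at h4
    nlinarith [mul_le_mul_of_nonneg_right h4 (norm_nonneg f)]
  refine h1.trans ?_
  rw [inv_mul_le_iff₀ hh']
  refine (Finset.sum_le_card_nsmul _ _ _ h2).trans_eq ?_
  simp [mul_add]

end Kernel

/-! ### Dependence of the covariance operator on the measure -/

section Drift

theorem norm_sub_le_of_norm_succ_sub_le {E : Type*} [NormedAddCommGroup E] {L : ℕ → E} {D : ℕ → ℝ}
    (hD : Antitone D) {k : ℕ} (hL : ∀ i ≥ k, ‖L (i + 1) - L i‖ ≤ D i) (j : ℕ) :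
    ‖L (k + j) - L k‖ ≤ j * D k := by
  induction j with
  | zero => simp
  | succ j ih =>
    have h1 := (hL (k + j) (by omega)).trans (hD (Nat.le_add_right k j))
    have e : L (k + (j + 1)) - L k = (L (k + j + 1) - L (k + j)) + (L (k + j) - L k) := by
      rw [← add_assoc]; abel
    rw [e]
    refine (norm_add_le _ _).trans ?_
    push_cast
    linarith

/-- Dividing `f` by `A + B` puts it in the unit ball of `C^s`. -/
theorem abs_integral_sub_le_of_holderDualENorm_le {X : Type*} [PseudoMetricSpace X]
    [MeasurableSpace X] {s : ℝ≥0} {ρ ρ' : Measure X} {D : ℝ} (hD : 0 ≤ D)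
    (hdual : holderDualENorm s ρ ρ' ≤ ENNReal.ofReal D) {f : X → ℝ} (hf : Continuous f) {A B : ℝ}
    (hA : 0 ≤ A) (hB : 0 ≤ B) (hfA : ∀ t, |f t| ≤ A)
    (hfB : ∀ u v, |f u - f v| ≤ B * dist u v ^ (s : ℝ)) :
    |(∫ t, f t ∂ρ) - ∫ t, f t ∂ρ'| ≤ (A + B) * D := by
  rcases (add_nonneg hA hB).eq_or_lt with h0 | h0
  · have : f = 0 := funext fun t => abs_nonpos_iff.1 ((hfA t).trans (by linarith))
    simp [this, ← h0]
  set N := A + B with hN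
  have hnorm : holderENorm s (fun t => N⁻¹ * f t) ≤ 1 := by
    have h1 : (⨆ x, ‖N⁻¹ * f x‖ₑ) ≤ ENNReal.ofReal (N⁻¹ * A) := iSup_le fun t => by
      rw [Real.enorm_eq_ofReal_abs, abs_mul, abs_of_pos (inv_pos.2 h0)]
      exact ENNReal.ofReal_le_ofReal (mul_le_mul_of_nonneg_left (hfA t) (inv_pos.2 h0).le)
    have h2 : eHolderNorm s (fun t => N⁻¹ * f t) ≤ ENNReal.ofReal (N⁻¹ * B) := by
      refine HolderWith.eHolderNorm_le fun u v => ?_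
      rw [edist_dist, edist_dist, Real.dist_eq, ← mul_sub, abs_mul, abs_of_pos (inv_pos.2 h0),
        ENNReal.ofReal_rpow_of_nonneg dist_nonneg s.coe_nonneg]
      change _ ≤ ENNReal.ofReal (N⁻¹ * B) * _
      rw [← ENNReal.ofReal_mul (by positivity), mul_assoc]
      exact ENNReal.ofReal_le_ofReal (mul_le_mul_of_nonneg_left (hfB u v) (inv_pos.2 h0).le)
    refine (add_le_add h1 h2).trans_eq ?_
    rw [← ENNReal.ofReal_add (by positivity) (by positivity), ← mul_add, ← hN,
      inv_mul_cancel₀ h0.ne', ENNReal.ofReal_one]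
  have h3 : ‖(∫ t, N⁻¹ * f t ∂ρ) - ∫ t, N⁻¹ * f t ∂ρ'‖ₑ ≤ ENNReal.ofReal D :=
    (iSup_le_iff.1 (iSup₂_le_iff.1 hdual (fun t => N⁻¹ * f t)
      ⟨continuous_const.mul hf, hnorm.trans_lt ENNReal.one_lt_top⟩)) hnorm
  rw [Real.enorm_eq_ofReal_abs, ENNReal.ofReal_le_ofReal_iff hD, integral_const_mul,
    integral_const_mul, ← mul_sub, abs_mul, abs_of_pos (inv_pos.2 h0), inv_mul_le_iff₀ h0] at h3
  exact h3

variable {X : Type*} [PseudoMetricSpace X] {H : Type*} [NormedAddCommGroup H]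
  [InnerProductSpace ℝ H] [CompleteSpace H] [RKHS ℝ H X ℝ]

theorem norm_kerSection_sub_le {K : X → X → ℝ} (hH : ∀ t u : X, RKHS.kernel H t u (1 : ℝ) = K t u)
    {s : ℝ≥0} {τ : ℝ} (hτ : 0 ≤ τ) (hK : HolderKernelCondition s τ K) (u v : X) :
    ‖kerSection H u - kerSection H v‖ ≤ √τ * dist u v ^ (s : ℝ) := by
  refine le_of_sq_le_sq ?_ (by positivity)
  rw [norm_kerSection_sub_sq hH, mul_pow, Real.sq_sqrt hτ]
  refine (le_abs_self _).trans ((hK.2 u v u v).trans_eq (by ring))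

variable [CompactSpace X] [MeasurableSpace X] [BorelSpace X]

/-- The bilinear form of the difference is `∫ f g d(ρ - ρ')`, and `f g` has sup norm at most `κ ‖f‖
‖g‖` and Hölder seminorm at most `2 √κ √τ ‖f‖ ‖g‖`. Testing with `g = (L - L') f` gives the operator
norm. -/
theorem norm_covOp_sub_le {K : X → X → ℝ} (hH : ∀ t u : X, RKHS.kernel H t u (1 : ℝ) = K t u)
    {s : ℝ≥0} {τ : ℝ} (hτ : 0 ≤ τ) (hK : HolderKernelCondition s τ K)
    (hφ : Continuous (kerSection H : X → H)) {κ : ℝ} (hκ0 : 0 ≤ κ)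
    (hκ : ∀ t : X, ‖kerSection H t‖ ^ 2 ≤ κ) {ρ ρ' : Measure X} [IsFiniteMeasure ρ]
    [IsFiniteMeasure ρ'] {D : ℝ} (hD : 0 ≤ D)
    (hdual : holderDualENorm s ρ ρ' ≤ ENNReal.ofReal D) :
    ‖covOp H ρ - covOp H ρ'‖ ≤ (κ + 2 * √κ * √τ) * D := by
  have hval : ∀ (f : H) t, |f t| ≤ √κ * ‖f‖ := fun f t => by
    have := Real.abs_le_sqrt (abs_apply_sq_le hκ f t)
    rwa [Real.sqrt_mul hκ0, Real.sqrt_sq (norm_nonneg _)] at this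
  have hdiff : ∀ (f : H) u v, |f u - f v| ≤ ‖f‖ * (√τ * dist u v ^ (s : ℝ)) := fun f u v => by
    rw [← inner_kerSection f u, ← inner_kerSection f v, ← inner_sub_right]
    exact (abs_real_inner_le_norm _ _).trans (mul_le_mul_of_nonneg_left
      (norm_kerSection_sub_le hH hτ hK u v) (norm_nonneg _))
  have key : ∀ f g : H, inner ℝ ((covOp H ρ - covOp H ρ') f) g
      ≤ (κ + 2 * √κ * √τ) * D * ‖f‖ * ‖g‖ := fun f g => by
    rw [sub_apply, inner_sub_left, inner_covOp hφ, inner_covOp hφ]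
    refine (le_abs_self _).trans ((abs_integral_sub_le_of_holderDualENorm_le hD hdual
      (f := fun t => f t * g t) ((continuous_coe hφ f).mul (continuous_coe hφ g)) (A := κ * (‖f‖ * ‖g‖))
      (B := 2 * √κ * √τ * (‖f‖ * ‖g‖)) (by positivity) (by positivity) (fun t => ?_)
      fun u v => ?_).trans_eq (by ring))
    · rw [abs_mul]
      refine (mul_le_mul (hval f t) (hval g t) (abs_nonneg _) (by positivity)).trans_eq ?_
      rw [mul_mul_mul_comm, Real.mul_self_sqrt hκ0]
    · have e : f u * g u - f v * g v = (f u - f v) * g u + f v * (g u - g v) := by ring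
      rw [e]
      refine (abs_add_le _ _).trans ?_
      rw [abs_mul, abs_mul]
      refine (add_le_add (mul_le_mul (hdiff f u v) (hval g u) (abs_nonneg _) (by positivity))
        (mul_le_mul (hval f v) (hdiff g u v) (abs_nonneg _) (by positivity))).trans_eq (by ring)
  refine ContinuousLinearMap.opNorm_le_bound _ (by positivity) fun f => ?_
  have h1 := key f ((covOp H ρ - covOp H ρ') f)
  rw [real_inner_self_eq_norm_sq, sq] at h1
  rcases (norm_nonneg ((covOp H ρ - covOp H ρ') f)).eq_or_lt with h0 | h0
  · rw [← h0]; positivity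
  · exact le_of_mul_le_mul_right h1 h0

end Drift

/-! ### The regularization path -/

section Path

variable {X : Type*} [TopologicalSpace X] [CompactSpace X] [MeasurableSpace X] [BorelSpace X]
  {H : Type*} [NormedAddCommGroup H] [InnerProductSpace ℝ H] [CompleteSpace H] [RKHS ℝ H X ℝ]

theorem isCocoercive_covOp_of_isProbabilityMeasure (hφ : Continuous (kerSection H : X → H)) {κ : ℝ}
    (hκ0 : 0 < κ) (hκ : ∀ t : X, ‖kerSection H t‖ ^ 2 ≤ κ) (ρ : Measure X)
    [IsProbabilityMeasure ρ] : IsCocoercive κ (covOp H ρ) :=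
  isCocoercive_covOp hφ hκ ρ hκ0 (by simp)

theorem tendsto_norm_regularized (hφ : Continuous (kerSection H : X → H)) {κ : ℝ} (hκ0 : 0 < κ)
    (hκ : ∀ t : X, ‖kerSection H t‖ ^ 2 ≤ κ) {ρ : ℕ → Measure X} [∀ i, IsProbabilityMeasure (ρ i)]
    {γ : Measure X} [IsFiniteMeasure γ] [γ.IsOpenPosMeasure] {h : ℕ} (hh : 0 < h)
    (hγ : ∀ k : ℕ, γ ≤ (h : ℝ≥0∞)⁻¹ • ∑ i ∈ Finset.Icc (k + 1) (k + h), ρ i) {D : ℕ → ℝ}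
    (hD0 : ∀ k, 0 ≤ D k) (hDanti : Antitone D) (hDlim : Tendsto D atTop (𝓝 0))
    (hdrift : ∀ᶠ k in atTop, ‖covOp H (ρ (k + 1)) - covOp H (ρ k)‖ ≤ D k) {lam : ℕ → ℝ}
    (hlam : ∀ k, 0 < lam k) (hlamlim : Tendsto lam atTop (𝓝 0)) {f : H} {w : ℕ → H}
    (hw : ∀ k, covOp H (ρ k) (w k) + lam k • w k = -(lam k • f)) :
    Tendsto (fun k => ‖w k‖) atTop (𝓝 0) := by
  have hco := fun k => isCocoercive_covOp_of_isProbabilityMeasure hφ hκ0 hκ (ρ k)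
  have hwf : ∀ k, ‖w k‖ ≤ ‖f‖ := fun k => (hco k).norm_regularized_le hκ0 (hlam k) (hw k)
  have hcoγ : IsCocoercive (max 1 (κ * γ.real Set.univ)) (covOp H γ) :=
    isCocoercive_covOp hφ hκ γ (lt_max_of_lt_left one_pos) (le_max_right _ _)
  have hγw : Tendsto (fun k => inner ℝ (covOp H γ (w k)) (w k)) atTop (𝓝 0) := by
    have hlim : Tendsto (fun k => lam k * ‖f‖ ^ 2 + h * D k * ‖f‖ ^ 2) atTop (𝓝 0) := by
      simpa using (hlamlim.mul_const (‖f‖ ^ 2)).add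
        ((hDlim.const_mul (h : ℝ)).mul_const (‖f‖ ^ 2))
    refine squeeze_zero' (Eventually.of_forall fun k =>
      hcoγ.inner_nonneg (lt_max_of_lt_left one_pos) _) ?_ hlim
    obtain ⟨N, hN⟩ := eventually_atTop.1 hdrift
    filter_upwards [eventually_ge_atTop N] with k hk
    have h1 : ∀ i ∈ Finset.Icc (k + 1) (k + h), ‖covOp H (ρ i) - covOp H (ρ k)‖ ≤ h * D k := by
      intro i hi
      obtain ⟨hi1, hi2⟩ := Finset.mem_Icc.1 hi
      obtain ⟨j, rfl⟩ := Nat.exists_eq_add_of_le (Nat.le_of_succ_le hi1)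
      refine (norm_sub_le_of_norm_succ_sub_le (L := fun i => covOp H (ρ i)) hDanti
        (fun i hi => hN i (hk.trans hi)) j).trans (mul_le_mul_of_nonneg_right ?_ (hD0 k))
      exact_mod_cast Nat.le_of_add_le_add_left hi2
    refine (inner_covOp_le_of_window hφ hh (hγ k) h1 (w k)).trans
      (add_le_add ((hco k).inner_regularized_le hκ0 (hlam k) (hw k)) ?_)
    exact mul_le_mul_of_nonneg_left (pow_le_pow_left₀ (norm_nonneg _) (hwf k) 2)
      (mul_nonneg (Nat.cast_nonneg h) (hD0 k))
  have hinner := (hcoγ.tendsto_inner_of_tendsto_inner_apply (inner_covOp_comm hφ γ)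
    (eq_zero_of_inner_covOp_eq_zero hφ γ) hwf hγw f).neg
  rw [neg_zero] at hinner
  -- Weak convergence becomes strong: dropping the nonnegative energy from the identity leaves
  -- `‖w_k‖² ≤ -⟪f, w_k⟫`.
  have hsq : Tendsto (fun k => ‖w k‖ ^ 2) atTop (𝓝 0) := by
    refine squeeze_zero (fun k => sq_nonneg _) (fun k => ?_) hinner
    have h1 := IsCocoercive.inner_add_sq_regularized (hw k)
    have h2 := (hco k).inner_nonneg hκ0 (w k)
    refine le_of_mul_le_mul_left ?_ (hlam k)
    linarith
  simpa using hsq.sqrt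

end Path

/-! ### One step of the algorithm in mean square -/

section Step

variable {H : Type*} [NormedAddCommGroup H] [InnerProductSpace ℝ H]

/-- Only the cross term `2a ⟪δ, ξ⟫` is kept, as it will have zero mean. The other one, in which `T`
and `ξ` share a sample, carries a factor `a²` and is split by Young's inequality. -/
theorem IsCocoercive.norm_step_sq_le {c : ℝ} {T : H →L[ℝ] H} (hc : 0 < c) (hT : IsCocoercive c T)
    {a l : ℝ} (ha : 0 ≤ a) (hl : 0 ≤ l) (hl1 : a * l ≤ 1) (hac : a * (c + 2 * l) ≤ 2) (δ ξ : H) :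
    ‖δ - a • (T δ + l • δ) + a • ξ‖ ^ 2 ≤
      ((1 - a * l) ^ 2 + a ^ 2 * (c + l) ^ 2) * ‖δ‖ ^ 2 + 2 * a * inner ℝ δ ξ
        + 2 * a ^ 2 * ‖ξ‖ ^ 2 := by
  have h1 : ‖δ - a • (T δ + l • δ)‖ ^ 2 ≤ (1 - a * l) ^ 2 * ‖δ‖ ^ 2 := by
    rw [← mul_pow]
    exact pow_le_pow_left₀ (norm_nonneg _) (hT.norm_sub_smul_le hc ha hl1 hac δ) 2
  have h2 : ‖T δ + l • δ‖ ≤ (c + l) * ‖δ‖ := by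
    refine (norm_add_le _ _).trans ?_
    rw [norm_smul, Real.norm_of_nonneg hl, add_mul]
    exact add_le_add (hT.norm_apply_le hc δ) le_rfl
  have h3 : -(2 * inner ℝ (T δ + l • δ) ξ) ≤ (c + l) ^ 2 * ‖δ‖ ^ 2 + ‖ξ‖ ^ 2 := by
    have h4 := neg_le_of_abs_le (abs_real_inner_le_norm (T δ + l • δ) ξ)
    have h5 := pow_le_pow_left₀ (norm_nonneg _) h2 2
    rw [mul_pow] at h5
    nlinarith [sq_nonneg (‖T δ + l • δ‖ - ‖ξ‖)]
  have h6 := mul_le_mul_of_nonneg_left h3 (sq_nonneg a)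
  rw [norm_add_sq_real, inner_sub_left, inner_smul_left, inner_smul_right, inner_smul_right,
    norm_smul, mul_pow, Real.norm_eq_abs, sq_abs]
  simp only [conj_trivial]
  nlinarith

variable {Ω : Type*} [MeasurableSpace Ω] {μ : Measure Ω}

theorem integral_norm_step_sq_le {c : ℝ} (hc : 0 < c) {T : Ω → H →L[ℝ] H}
    (hT : ∀ ω, IsCocoercive c (T ω)) {a l : ℝ} (ha : 0 ≤ a) (hl : 0 ≤ l) (hl1 : a * l ≤ 1)
    (hac : a * (c + 2 * l) ≤ 2) {δ ξ : Ω → H} (hδ : MemLp δ 2 μ) (hξ : MemLp ξ 2 μ)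
    (hδξ : ∫ ω, inner ℝ (δ ω) (ξ ω) ∂μ = 0) :
    ∫ ω, ‖δ ω - a • (T ω (δ ω) + l • δ ω) + a • ξ ω‖ ^ 2 ∂μ ≤
      ((1 - a * l) ^ 2 + a ^ 2 * (c + l) ^ 2) * ∫ ω, ‖δ ω‖ ^ 2 ∂μ
        + 2 * a ^ 2 * ∫ ω, ‖ξ ω‖ ^ 2 ∂μ := by
  have i1 : Integrable (fun ω => ‖δ ω‖ ^ 2) μ := hδ.norm.integrable_sq
  have i2 : Integrable (fun ω => ‖ξ ω‖ ^ 2) μ := hξ.norm.integrable_sq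
  have i3 : Integrable (fun ω => inner ℝ (δ ω) (ξ ω)) μ := by
    refine (i1.add i2).mono' (hδ.1.inner hξ.1) (Eventually.of_forall fun ω => ?_)
    refine (norm_inner_le_norm _ _).trans ?_
    simp only [Pi.add_apply]
    nlinarith [sq_nonneg (‖δ ω‖ - ‖ξ ω‖), sq_nonneg ‖δ ω‖, sq_nonneg ‖ξ ω‖]
  refine (integral_mono_of_nonneg (Eventually.of_forall fun ω => sq_nonneg _)
    (((i1.const_mul _).add (i3.const_mul (2 * a))).add (i2.const_mul (2 * a ^ 2)))
    (Eventually.of_forall fun ω =>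
      (hT ω).norm_step_sq_le hc ha hl hl1 hac (δ ω) (ξ ω))).trans_eq ?_
  rw [integral_add' ((i1.const_mul _).add (i3.const_mul (2 * a))) (i2.const_mul (2 * a ^ 2)),
    integral_add' (i1.const_mul _) (i3.const_mul (2 * a)), integral_const_mul, integral_const_mul,
    integral_const_mul, hδξ]
  ring

omit [InnerProductSpace ℝ H] in
theorem integral_norm_add_const_sq_le [IsProbabilityMeasure μ] {δ : Ω → H} (hδ : MemLp δ 2 μ)
    (w : H) {η : ℝ} (hη : 0 < η) :
    ∫ ω, ‖δ ω + w‖ ^ 2 ∂μ ≤ (1 + η) * ∫ ω, ‖δ ω‖ ^ 2 ∂μ + (1 + 1 / η) * ‖w‖ ^ 2 := by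
  have i1 : Integrable (fun ω => ‖δ ω‖ ^ 2) μ := hδ.norm.integrable_sq
  refine (integral_mono_of_nonneg (Eventually.of_forall fun ω => sq_nonneg _)
    ((i1.const_mul (1 + η)).add (integrable_const ((1 + 1 / η) * ‖w‖ ^ 2)))
    (Eventually.of_forall fun ω => ?_)).trans_eq ?_
  · have h1 := pow_le_pow_left₀ (norm_nonneg _) (norm_add_le (δ ω) w) 2
    have h2 : 0 ≤ (η * ‖δ ω‖ - ‖w‖) ^ 2 / η := by positivity
    have h3 : (η * ‖δ ω‖ - ‖w‖) ^ 2 / η =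
        η * ‖δ ω‖ ^ 2 - 2 * ‖δ ω‖ * ‖w‖ + 1 / η * ‖w‖ ^ 2 := by field_simp; ring
    simp only [Pi.add_apply]
    nlinarith
  · rw [integral_add' (i1.const_mul _) (integrable_const _), integral_const_mul]
    simp

end Step

/-! ### The estimates -/

section Estimate

theorem indepFun_past {X Ω : Type*} [MeasurableSpace X] [MeasurableSpace Ω] {μ : Measure Ω}
    {x : ℕ → Ω → X} {y : ℕ → Ω → ℝ} (hx : ∀ k, Measurable (x k))
    (hy : ∀ k, Measurable (y k)) (hindep : iIndepFun (fun k ω => (x k ω, y k ω)) μ) (k : ℕ) :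
    IndepFun (fun ω (i : Finset.range k) => (x i ω, y i ω)) (fun ω => (x k ω, y k ω)) μ := by
  have h := hindep.indepFun_finset (Finset.range k) {k} (by simp)
    fun i => (hx i).prodMk (hy i)
  exact h.comp (φ := id) (ψ := fun z : ({k} : Finset ℕ) → X × ℝ => z ⟨k, by simp⟩)
    measurable_id (measurable_pi_apply _)

variable {X : Type*} {Ω : Type*} {H : Type*} [NormedAddCommGroup H]
  [InnerProductSpace ℝ H] [CompleteSpace H] [RKHS ℝ H X ℝ]

/-- By `hw`, `λ_k (f* + w) = -L w`. The residual noise is therefore `v_k K_{x_k}` minus the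
deviation of the sampled operator from `L`, evaluated at the deterministic `w`. -/
theorem estimate_succ_sub {a lam : ℕ → ℝ} {x : ℕ → Ω → X} {y v : ℕ → Ω → ℝ} {f₀ fstar : H}
    (hmodel : ∀ k ω, y k ω = fstar (x k ω) + v k ω) {k : ℕ} {L : H →L[ℝ] H} {w : H}
    (hw : L w + lam k • w = -(lam k • fstar)) (ω : Ω) :
    estimate a lam x y f₀ (k + 1) ω - (fstar + w) =
      (estimate a lam x y f₀ k ω - (fstar + w))
        - a k • (evalOp H (x k ω) (estimate a lam x y f₀ k ω - (fstar + w))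
          + lam k • (estimate a lam x y f₀ k ω - (fstar + w)))
        + a k • (v k ω • kerSection H (x k ω) - (evalOp H (x k ω) w - L w)) := by
  rw [eq_sub_of_add_eq hw]
  simp only [estimate, evalOp_apply, hmodel, RKHS.coe_sub, RKHS.coe_add, Pi.sub_apply,
    Pi.add_apply]
  module

variable [TopologicalSpace X]

/-- Independence of the data passes to `f_k` through this factorization; continuity of `G` supplies
strong measurability in `H`, which is not assumed separable. -/
theorem exists_continuous_estimate_eq (hφ : Continuous (kerSection H : X → H)) (a lam : ℕ → ℝ)
    (x : ℕ → Ω → X) (y : ℕ → Ω → ℝ) (f₀ : H) (k : ℕ) :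
    ∃ G : (Finset.range k → X × ℝ) → H, Continuous G ∧
      ∀ ω, estimate a lam x y f₀ k ω = G fun i => (x i ω, y i ω) := by
  induction k with
  | zero => exact ⟨fun _ => f₀, continuous_const, fun _ => rfl⟩
  | succ k ih =>
    obtain ⟨G, hG, hGe⟩ := ih
    let r : (Finset.range (k + 1) → X × ℝ) → Finset.range k → X × ℝ := fun z i =>
      z ⟨i, Finset.range_subset_range.2 k.le_succ i.2⟩
    let p : (Finset.range (k + 1) → X × ℝ) → X × ℝ := fun z =>
      z ⟨k, Finset.self_mem_range_succ k⟩
    have hr : Continuous r := continuous_pi fun i => continuous_apply _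
    have hp : Continuous p := continuous_apply _
    refine ⟨fun z => G (r z) - a k • ((inner ℝ (G (r z)) (kerSection H (p z).1) - (p z).2) •
      kerSection H (p z).1 + lam k • G (r z)), ?_, fun ω => ?_⟩
    · have h1 := hG.comp hr
      have h2 := hφ.comp hp.fst
      exact h1.sub (((((h1.inner h2).sub hp.snd).smul h2).add (h1.const_smul _)).const_smul _)
    · simp only [estimate, hGe ω, inner_kerSection]
      rfl

end Estimate

/-! ### Moments of the iterates and the mean square recursion -/

section Convergence

variable {X : Type*} [TopologicalSpace X] [CompactSpace X] [SecondCountableTopology X]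
  [MeasurableSpace X] [BorelSpace X]
  {Ω : Type*} [MeasurableSpace Ω] {μ : Measure Ω} [IsProbabilityMeasure μ]
  {H : Type*} [NormedAddCommGroup H] [InnerProductSpace ℝ H] [CompleteSpace H] [RKHS ℝ H X ℝ]

omit [CompactSpace X] [IsProbabilityMeasure μ] in
theorem memLp_smul_kerSection (hφ : Continuous (kerSection H : X → H)) {κ : ℝ}
    (hκ : ∀ t : X, ‖kerSection H t‖ ^ 2 ≤ κ) {x : Ω → X} (hx : Measurable x) {u : Ω → ℝ}
    (hu : MemLp u 2 μ) : MemLp (fun ω => u ω • kerSection H (x ω)) 2 μ := by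
  have h1 : StronglyMeasurable fun ω => kerSection H (x ω) :=
    hφ.stronglyMeasurable.comp_measurable hx
  refine hu.of_le_mul (hu.1.smul h1.aestronglyMeasurable) (c := √κ)
    (Eventually.of_forall fun ω => ?_)
  rw [norm_smul, mul_comm]
  exact mul_le_mul_of_nonneg_right (Real.le_sqrt_of_sq_le (hκ _)) (norm_nonneg _)

omit [CompactSpace X] [IsProbabilityMeasure μ] in
theorem memLp_evalOp_apply (hφ : Continuous (kerSection H : X → H)) {κ : ℝ} (hκ0 : 0 < κ)
    (hκ : ∀ t : X, ‖kerSection H t‖ ^ 2 ≤ κ) {x : Ω → X} (hx : Measurable x) {f : Ω → H}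
    (hf : MemLp f 2 μ) : MemLp (fun ω => evalOp H (x ω) (f ω)) 2 μ := by
  have h1 : StronglyMeasurable fun ω => kerSection H (x ω) :=
    hφ.stronglyMeasurable.comp_measurable hx
  refine hf.of_le_mul (c := κ) ?_ (Eventually.of_forall fun ω =>
    (isCocoercive_evalOp hκ (x ω)).norm_apply_le hκ0 (f ω))
  simp_rw [evalOp_apply, ← inner_kerSection]
  exact (hf.1.inner h1.aestronglyMeasurable).smul h1.aestronglyMeasurable

omit [CompactSpace X] in
theorem memLp_estimate (hφ : Continuous (kerSection H : X → H)) {κ : ℝ} (hκ0 : 0 < κ)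
    (hκ : ∀ t : X, ‖kerSection H t‖ ^ 2 ≤ κ) (a lam : ℕ → ℝ) {x : ℕ → Ω → X}
    (hx : ∀ k, Measurable (x k)) {y v : ℕ → Ω → ℝ} (hv : ∀ k, MemLp (v k) 2 μ) (f₀ : H) {fstar : H}
    (hmodel : ∀ k ω, y k ω = fstar (x k ω) + v k ω) (k : ℕ) :
    MemLp (estimate a lam x y f₀ k) 2 μ := by
  induction k with
  | zero => exact memLp_const f₀
  | succ k ih =>
    have e : estimate a lam x y f₀ (k + 1) = fun ω => estimate a lam x y f₀ k ω -
        a k • (evalOp H (x k ω) (estimate a lam x y f₀ k ω) - evalOp H (x k ω) fstar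
          - v k ω • kerSection H (x k ω) + lam k • estimate a lam x y f₀ k ω) := by
      funext ω
      simp only [estimate, evalOp_apply, hmodel]
      module
    rw [e]
    exact ih.sub ((((memLp_evalOp_apply hφ hκ0 hκ (hx k) ih).sub
      (memLp_evalOp_apply hφ hκ0 hκ (hx k) (memLp_const fstar))).sub
      (memLp_smul_kerSection hφ hκ (hx k) (hv k))).add (ih.const_smul (lam k))
      |>.const_smul (a k))

omit [SecondCountableTopology X] in
theorem integral_evalOp_apply (hφ : Continuous (kerSection H : X → H)) {x : Ω → X}
    (hx : Measurable x) (w : H) :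
    ∫ ω, evalOp H (x ω) w ∂μ = covOp H (μ.map x) w := by
  have := Measure.isProbabilityMeasure_map (μ := μ) hx.aemeasurable
  rw [covOp_apply hφ]
  exact (integral_map hx.aemeasurable (integrable_of_continuous (μ.map x)
    ((continuous_evalOp hφ).clm_apply continuous_const)).aestronglyMeasurable).symm

/-- The fluctuation of the update around its mean vanishes in expectation against the past. -/
theorem integral_inner_estimate_sub_fluctuation (hφ : Continuous (kerSection H : X → H)) {κ : ℝ}
    (hκ0 : 0 < κ) (hκ : ∀ t : X, ‖kerSection H t‖ ^ 2 ≤ κ) (a lam : ℕ → ℝ) {x : ℕ → Ω → X}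
    (hx : ∀ k, Measurable (x k)) {y v : ℕ → Ω → ℝ} (hy : ∀ k, Measurable (y k))
    (hv : ∀ k, MemLp (v k) 2 μ) (f₀ : H) {fstar : H}
    (hmodel : ∀ k ω, y k ω = fstar (x k ω) + v k ω)
    (hindep : iIndepFun (fun k ω => (x k ω, y k ω)) μ) (k : ℕ)
    (hvK : ∫ ω, v k ω • kerSection H (x k ω) ∂μ = 0) (u w : H) :
    ∫ ω, inner ℝ (estimate a lam x y f₀ k ω - u) (v k ω • kerSection H (x k ω) -
      (evalOp H (x k ω) w - covOp H (μ.map (x k)) w)) ∂μ = 0 := by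
  obtain ⟨G, hG, hGe⟩ := exists_continuous_estimate_eq hφ a lam x y f₀ k
  set L := covOp H (μ.map (x k)) with hL
  let P : Ω → Finset.range k → X × ℝ := fun ω i => (x i ω, y i ω)
  let Q : Ω → X × ℝ := fun ω => (x k ω, y k ω)
  -- Since `v_k = y_k - f*(x_k)`, the fluctuation is a function of the current pair alone.
  let g : X × ℝ → H := fun p => (p.2 - inner ℝ fstar (kerSection H p.1)) • kerSection H p.1 -
    (inner ℝ w (kerSection H p.1) • kerSection H p.1 - L w)
  have hP : Measurable P := measurable_pi_lambda _ fun i => (hx i).prodMk (hy i)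
  have hQ : Measurable Q := (hx k).prodMk (hy k)
  have hφ1 : Continuous fun p : X × ℝ => kerSection H p.1 := hφ.comp continuous_fst
  have hg : Continuous g :=
    ((continuous_snd.sub (continuous_const.inner hφ1)).smul hφ1).sub
      (((continuous_const.inner hφ1).smul hφ1).sub continuous_const)
  have hgQ : ∀ ω, g (Q ω) = v k ω • kerSection H (x k ω) - (evalOp H (x k ω) w - L w) :=
    fun ω => by
      simp only [g, Q, inner_kerSection, hmodel, add_sub_cancel_left, evalOp_apply]
  have iv : Integrable (fun ω => v k ω • kerSection H (x k ω)) μ :=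
    (memLp_smul_kerSection hφ hκ (hx k) (hv k)).integrable one_le_two
  have iw : Integrable (fun ω => evalOp H (x k ω) w) μ :=
    (memLp_evalOp_apply hφ hκ0 hκ (hx k) (memLp_const w)).integrable one_le_two
  have iwL : Integrable (fun ω => evalOp H (x k ω) w - L w) μ := iw.sub (integrable_const _)
  have ig : Integrable (fun ω => g (Q ω)) μ := by
    simp_rw [hgQ]
    exact iv.sub iwL
  have iG : Integrable (fun ω => G (P ω) - u) μ := by
    have : (fun ω => G (P ω) - u) = fun ω => estimate a lam x y f₀ k ω - u :=
      funext fun ω => by rw [hGe]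
    rw [this]
    exact ((memLp_estimate hφ hκ0 hκ a lam hx hv f₀ hmodel k).integrable one_le_two).sub
      (integrable_const _)
  have hmean : ∫ ω, g (Q ω) ∂μ = 0 := by
    simp_rw [hgQ]
    rw [integral_sub iv iwL, integral_sub iw (integrable_const _), hvK,
      integral_evalOp_apply hφ (hx k), ← hL]
    simp
  -- By independence the expected inner product is the inner product of the means, one of which is
  -- zero.
  have key := (indepFun_past hx hy hindep k).integral_bilin_comp_comp
    (f := fun z => G z - u) (g := g) hP.aemeasurable hQ.aemeasurable
    ((integrable_map_measure (hG.sub continuous_const).stronglyMeasurable.aestronglyMeasurable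
      hP.aemeasurable).2 iG)
    ((integrable_map_measure hg.stronglyMeasurable.aestronglyMeasurable hQ.aemeasurable).2 ig)
    (innerSL ℝ)
  change ∫ ω, inner ℝ (G (P ω) - u) (g (Q ω)) ∂μ =
    inner ℝ (∫ ω, G (P ω) - u ∂μ) (∫ ω, g (Q ω) ∂μ) at key
  rw [hmean, inner_zero_right] at key
  rw [← key]
  exact integral_congr_ae (Eventually.of_forall fun ω => by simp only [hgQ, hGe ω, P])

omit [SecondCountableTopology X] in
theorem integral_norm_fluctuation_sq_le (hφ : Continuous (kerSection H : X → H)) {κ : ℝ}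
    (hκ0 : 0 < κ) (hκ : ∀ t : X, ‖kerSection H t‖ ^ 2 ≤ κ) {x : Ω → X} (hx : Measurable x)
    {v : Ω → ℝ} (hv : MemLp v 2 μ) {β : ℝ} (hβ : ∫ ω, v ω ^ 2 ∂μ ≤ β) {w : H} {F : ℝ}
    (hw : ‖w‖ ≤ F) :
    ∫ ω, ‖v ω • kerSection H (x ω) - (evalOp H (x ω) w - covOp H (μ.map x) w)‖ ^ 2 ∂μ ≤
      2 * κ * β + 8 * κ ^ 2 * F ^ 2 := by
  have := Measure.isProbabilityMeasure_map (μ := μ) hx.aemeasurable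
  have i1 : Integrable (fun ω => v ω ^ 2) μ := hv.integrable_sq
  refine (integral_mono_of_nonneg (Eventually.of_forall fun ω => sq_nonneg _)
    ((i1.const_mul (2 * κ)).add (integrable_const (8 * κ ^ 2 * F ^ 2)))
    (Eventually.of_forall fun ω => ?_)).trans ?_
  · have h1 : ‖v ω • kerSection H (x ω)‖ ^ 2 ≤ κ * v ω ^ 2 := by
      rw [norm_smul, mul_pow, Real.norm_eq_abs, sq_abs, mul_comm]
      exact mul_le_mul_of_nonneg_right (hκ _) (sq_nonneg _)
    have h2 : ‖evalOp H (x ω) w - covOp H (μ.map x) w‖ ≤ 2 * κ * F := by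
      have h3 := (isCocoercive_evalOp hκ (x ω)).norm_apply_le hκ0 w
      have h4 := (isCocoercive_covOp_of_isProbabilityMeasure hφ hκ0 hκ (μ.map x)).norm_apply_le
        hκ0 w
      have h5 := mul_le_mul_of_nonneg_left hw hκ0.le
      linarith [norm_sub_le (evalOp H (x ω) w) (covOp H (μ.map x) w)]
    have h6 := pow_le_pow_left₀ (norm_nonneg _) h2 2
    have h7 := pow_le_pow_left₀ (norm_nonneg _) (norm_sub_le (v ω • kerSection H (x ω))
      (evalOp H (x ω) w - covOp H (μ.map x) w)) 2
    simp only [Pi.add_apply]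
    nlinarith [sq_nonneg (‖v ω • kerSection H (x ω)‖ -
      ‖evalOp H (x ω) w - covOp H (μ.map x) w‖)]
  · rw [integral_add' (i1.const_mul _) (integrable_const _), integral_const_mul]
    have := mul_le_mul_of_nonneg_left hβ (by positivity : 0 ≤ 2 * κ)
    simp only [integral_const, probReal_univ, one_smul]
    linarith

omit [TopologicalSpace X] [CompactSpace X] [SecondCountableTopology X] [MeasurableSpace X]
  [BorelSpace X] in
theorem NoiseAssumption.integral_smul_kerSection_eq_zero {𝒢 : ℕ → MeasurableSpace Ω}
    {x : ℕ → Ω → X} {v : ℕ → Ω → ℝ} (h : NoiseAssumption H μ 𝒢 x v) (k : ℕ)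
    (hle : 𝒢 k ≤ ‹MeasurableSpace Ω›) : ∫ ω, v k ω • kerSection H (x k ω) ∂μ = 0 := by
  rw [← integral_condExp hle, integral_congr_ae (h.2.1 k).2.2]
  simp

omit [TopologicalSpace X] [CompactSpace X] [SecondCountableTopology X] [MeasurableSpace X]
  [BorelSpace X] in
theorem NoiseAssumption.exists_bound {𝒢 : ℕ → MeasurableSpace Ω}
    {x : ℕ → Ω → X} {v : ℕ → Ω → ℝ} (h : NoiseAssumption H μ 𝒢 x v)
    (hle : ∀ k, 𝒢 k ≤ ‹MeasurableSpace Ω›) :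
    ∃ β : ℝ, 0 < β ∧ ∀ k, MemLp (v k) 2 μ ∧ ∫ ω, v k ω ^ 2 ∂μ ≤ β := by
  obtain ⟨β, hβ0, hβ⟩ := h.2.2
  refine ⟨β, hβ0, fun k => ⟨(hβ k).1, ?_⟩⟩
  rw [← integral_condExp (hle k)]
  refine (integral_mono_ae integrable_condExp (integrable_const β) (hβ k).2).trans_eq ?_
  simp

theorem eLpNorm_two_sq_eq_ofReal_integral {Ω E : Type*} [MeasurableSpace Ω] {μ : Measure Ω}
    [NormedAddCommGroup E] {f : Ω → E} (hf : MemLp f 2 μ) :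
    eLpNorm f 2 μ ^ 2 = ENNReal.ofReal (∫ ω, ‖f ω‖ ^ 2 ∂μ) := by
  have h0 : 0 ≤ ∫ ω, ‖f ω‖ ^ 2 ∂μ := integral_nonneg fun ω => sq_nonneg _
  rw [hf.eLpNorm_eq_integral_rpow_norm two_ne_zero ENNReal.ofNat_ne_top,
    ← ENNReal.ofReal_pow (by positivity)]
  simp only [ENNReal.toReal_ofNat, Real.rpow_two]
  rw [← Real.rpow_two, ← Real.rpow_mul h0, inv_mul_cancel₀ two_ne_zero, Real.rpow_one]

/-- Mean square contraction of the error around the regularization path. -/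
theorem integral_norm_estimate_sub_sq_le (hφ : Continuous (kerSection H : X → H)) {κ : ℝ}
    (hκ0 : 0 < κ) (hκ : ∀ t : X, ‖kerSection H t‖ ^ 2 ≤ κ) {a lam : ℕ → ℝ} {x : ℕ → Ω → X}
    (hx : ∀ k, Measurable (x k)) {y v : ℕ → Ω → ℝ} (hy : ∀ k, Measurable (y k)) {β : ℝ}
    (hv : ∀ k, MemLp (v k) 2 μ ∧ ∫ ω, v k ω ^ 2 ∂μ ≤ β) (f₀ : H) {fstar : H}
    (hmodel : ∀ k ω, y k ω = fstar (x k ω) + v k ω)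
    (hindep : iIndepFun (fun k ω => (x k ω, y k ω)) μ) {k : ℕ}
    (hvK : ∫ ω, v k ω • kerSection H (x k ω) ∂μ = 0) (ha : 0 < a k) (hl : 0 < lam k)
    (hl1 : lam k ≤ 1) (hal : a k ≤ 1) (hac : a k * (κ + 2) ≤ 2)
    (hacl : a k / lam k * (κ + 1) ^ 2 ≤ 1 / 4) {w w' : H}
    (hw : covOp H (μ.map (x k)) w + lam k • w = -(lam k • fstar)) {ε : ℝ}
    (hww' : ‖w' - w‖ ≤ a k * lam k * ε) :
    ∫ ω, ‖estimate a lam x y f₀ (k + 1) ω - (fstar + w')‖ ^ 2 ∂μ ≤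
      (1 - a k * lam k / 2) * ∫ ω, ‖estimate a lam x y f₀ k ω - (fstar + w)‖ ^ 2 ∂μ +
      a k * lam k / 2 *
        (10 * ε ^ 2 + 8 * (2 * κ * β + 8 * κ ^ 2 * ‖fstar‖ ^ 2) * (a k / lam k)) := by
  have := Measure.isProbabilityMeasure_map (μ := μ) (hx k).aemeasurable
  have hα0 : 0 < a k * lam k := mul_pos ha hl
  have hα1 : a k * lam k ≤ 1 := mul_le_one₀ hal hl.le hl1
  have hest := memLp_estimate hφ hκ0 hκ a lam hx (fun k => (hv k).1) f₀ hmodel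
  have hwf : ‖w‖ ≤ ‖fstar‖ := (isCocoercive_covOp_of_isProbabilityMeasure hφ hκ0 hκ
    (μ.map (x k))).norm_regularized_le hκ0 hl hw
  have hξ : MemLp (fun ω => v k ω • kerSection H (x k ω) -
      (evalOp H (x k ω) w - covOp H (μ.map (x k)) w)) 2 μ :=
    (memLp_smul_kerSection hφ hκ (hx k) (hv k).1).sub
      ((memLp_evalOp_apply hφ hκ0 hκ (hx k) (memLp_const w)).sub (memLp_const _))
  have hstep := integral_norm_step_sq_le hκ0 (fun ω => isCocoercive_evalOp hκ (x k ω)) ha.le hl.le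
    hα1 ((mul_le_mul_of_nonneg_left (by linarith) ha.le).trans hac)
    ((hest k).sub (memLp_const (fstar + w))) hξ
    (integral_inner_estimate_sub_fluctuation hφ hκ0 hκ a lam hx hy (fun k => (hv k).1) f₀ hmodel
      hindep k hvK (fstar + w) w)
  have hM := integral_norm_fluctuation_sq_le hφ hκ0 hκ (hx k) (hv k).1 (hv k).2 hwf
  set M := 2 * κ * β + 8 * κ ^ 2 * ‖fstar‖ ^ 2 with hMdef
  simp only [Pi.sub_apply] at hstep
  simp_rw [← estimate_succ_sub hmodel hw] at hstep
  -- The choice `η = α / 4`, with `α = a_k λ_k`, spends a quarter of the rate: `(1 + α/4)(1 - 3α/4)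
  -- ≤ 1 - α/2`. The weight `1 + 4/α` is compensated by the `α²` in `‖w' - w‖²`.
  have hshift := integral_norm_add_const_sq_le ((hest (k + 1)).sub (memLp_const (fstar + w)))
    (w - w') (η := a k * lam k / 4) (by positivity)
  simp only [Pi.sub_apply, fun z : H => (by abel : z - (fstar + w) + (w - w') =
    z - (fstar + w'))] at hshift
  refine hshift.trans ?_
  set b := ∫ ω, ‖estimate a lam x y f₀ k ω - (fstar + w)‖ ^ 2 ∂μ with hb
  set p := ∫ ω, ‖estimate a lam x y f₀ (k + 1) ω - (fstar + w)‖ ^ 2 ∂μ with hp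
  have hb0 : 0 ≤ b := integral_nonneg fun ω => sq_nonneg _
  have hM0 : 0 ≤ M := (integral_nonneg fun ω => sq_nonneg _).trans hM
  set α := a k * lam k with hα
  have ha2 : a k ^ 2 = α * (a k / lam k) := by rw [hα]; field_simp
  have hcoef : a k ^ 2 * (κ + lam k) ^ 2 ≤ α / 4 := by
    have h1 : (κ + lam k) ^ 2 ≤ (κ + 1) ^ 2 := by gcongr
    rw [ha2]
    have h2 : a k / lam k * (κ + lam k) ^ 2 ≤ 1 / 4 :=
      (mul_le_mul_of_nonneg_left h1 (by positivity)).trans hacl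
    nlinarith
  have hp' : p ≤ (1 - 3 * α / 4) * b + 2 * α * (a k / lam k) * M := by
    -- As `α ≤ 1`, `(1 - α)² ≤ 1 - α`, and the second-order term takes back at most `α / 4`.
    have h1 : (1 - α) ^ 2 + a k ^ 2 * (κ + lam k) ^ 2 ≤ 1 - 3 * α / 4 := by nlinarith
    have h2 := mul_le_mul_of_nonneg_right h1 hb0
    have h3 := mul_le_mul_of_nonneg_left hM (by positivity : 0 ≤ 2 * a k ^ 2)
    rw [ha2] at h3 hstep
    rw [ha2] at h2
    linarith
  have hw2 : (1 + 1 / (α / 4)) * ‖w - w'‖ ^ 2 ≤ 5 * α * ε ^ 2 := by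
    have h1 := pow_le_pow_left₀ (norm_nonneg _) hww' 2
    rw [norm_sub_rev]
    calc (1 + 1 / (α / 4)) * ‖w' - w‖ ^ 2 ≤ (1 + 1 / (α / 4)) * (α * ε) ^ 2 :=
          mul_le_mul_of_nonneg_left h1 (by positivity)
      _ = (α + 4) * α * ε ^ 2 := by field_simp
      _ ≤ 5 * α * ε ^ 2 := by
          refine mul_le_mul_of_nonneg_right ?_ (sq_nonneg ε)
          exact mul_le_mul_of_nonneg_right (by linarith) hα0.le
  have hr : 0 ≤ α * (a k / lam k) * M := by positivity
  have h4 : (1 + α / 4) * p ≤ (1 - α / 2) * b + 4 * (α * (a k / lam k) * M) := by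
    have h5 := mul_le_mul_of_nonneg_left hp' (by positivity : 0 ≤ 1 + α / 4)
    nlinarith [mul_nonneg (sq_nonneg α) hb0]
  linarith

end Convergence

end OnlineRKHS

/-! ### Assembly of the convergence theorem -/

open OnlineRKHS

theorem mainTheorem2 {n : ℕ} (𝒳 : Set (EuclideanSpace ℝ (Fin n))) (h𝒳 : IsCompact 𝒳)
    -- the kernel `K` and its reproducing kernel Hilbert space `H`
    (K : 𝒳 → 𝒳 → ℝ) (hK : OnlineRKHS.IsPosDefKernel K)
    {H : Type*} [NormedAddCommGroup H] [InnerProductSpace ℝ H] [CompleteSpace H]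
    [RKHS ℝ H 𝒳 ℝ] (hH : ∀ t u : 𝒳, RKHS.kernel H t u (1 : ℝ) = K t u)
    -- the statistical learning model
    {Ω : Type*} [MeasurableSpace Ω] (μ : Measure Ω) [IsProbabilityMeasure μ]
    (x : ℕ → Ω → 𝒳) (hx : ∀ k, Measurable (x k))
    (y : ℕ → Ω → ℝ) (hy : ∀ k, Measurable (y k))
    (v : ℕ → Ω → ℝ) (hv : ∀ k, Measurable (v k))
    (fstar : H) (hmodel : ∀ k ω, y k ω = fstar (x k ω) + v k ω)
    (hnoise : OnlineRKHS.NoiseAssumption H μ (OnlineRKHS.pastSigma K x y) x v)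
    -- the Hölder kernel condition
    (s : ℝ≥0) (hs : s ≤ 1) (τ : ℝ) (hτ : 0 < τ) (hKs : OnlineRKHS.HolderKernelCondition s τ K)
    -- gains, regularization parameters and initial value of the algorithm
    (a lam : ℕ → ℝ) (hgain : OnlineRKHS.GainCondition a lam) (f₀ : H)
    -- independent data
    (hindep : iIndepFun (fun k ω => (x k ω, y k ω)) μ)
    -- window averages of the marginals dominate a strictly positive measure
    (h : ℕ) (hh : 0 < h) (γ : Measure 𝒳) [IsFiniteMeasure γ] [γ.IsOpenPosMeasure]
    (hγ : ∀ k : ℕ, γ ≤ (h : ℝ≥0∞)⁻¹ • ∑ i ∈ Finset.Icc (k + 1) (k + h), μ.map (x i))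
    -- slowly varying marginals
    (hdrift : ∃ C : ℝ≥0, ∀ᶠ k in atTop,
      OnlineRKHS.holderDualENorm s (μ.map (x (k + 1))) (μ.map (x k))
        ≤ C * ENNReal.ofReal (a k * lam k ^ 2)) :
    (∀ k, MemLp (fun ω => OnlineRKHS.estimate a lam x y f₀ k ω - fstar) 2 μ) ∧
      Tendsto (fun k =>
        eLpNorm (fun ω => OnlineRKHS.estimate a lam x y f₀ k ω - fstar) 2 μ ^ 2)
        atTop (𝓝 0) := by
  have : CompactSpace 𝒳 := isCompact_iff_compactSpace.1 h𝒳
  have hKc := hKs.1.1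
  have hφ : Continuous (kerSection H : 𝒳 → H) := continuous_kerSection hH hKc
  obtain ⟨κ, hκ0, hκ⟩ : ∃ κ : ℝ, 0 < κ ∧ ∀ t : 𝒳, ‖kerSection H t‖ ^ 2 ≤ κ := by
    obtain ⟨C, hC⟩ := isCompact_univ.exists_bound_of_continuousOn (hφ.norm.pow 2).continuousOn
    exact ⟨max 1 C, lt_max_of_lt_left one_pos, fun t =>
      ((le_abs_self _).trans (hC t (Set.mem_univ t))).trans (le_max_right 1 C)⟩
  have hle : ∀ k, pastSigma K x y k ≤ ‹MeasurableSpace Ω› := pastSigma_le K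
    (fun t => (hKc.comp (continuous_const.prodMk continuous_id)).measurable) x hx y hy
  obtain ⟨β, hβ0, hβ⟩ := hnoise.exists_bound hle
  have hvK := fun k => hnoise.integral_smul_kerSection_eq_zero k (hle k)
  have hest := memLp_estimate hφ hκ0 hκ a lam hx (fun k => (hβ k).1) f₀ hmodel
  refine ⟨fun k => (hest k).sub (memLp_const fstar), ?_⟩
  have hρ : ∀ k, IsProbabilityMeasure (μ.map (x k)) := fun k =>
    Measure.isProbabilityMeasure_map (hx k).aemeasurable
  have ha := hgain.a_pos
  have hl := hgain.lam_pos
  have hco := fun k => isCocoercive_covOp_of_isProbabilityMeasure hφ hκ0 hκ (μ.map (x k))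
  choose w hw using fun k => (hco k).exists_regularized hκ0 (hl k) (-(lam k • fstar))
  have hwf := fun k => (hco k).norm_regularized_le hκ0 (hl k) (hw k)
  -- the covariance operators vary slowly
  obtain ⟨C, hC⟩ := hdrift
  set B : ℝ := (κ + 2 * √κ * √τ) * C with hB
  have hB0 : 0 ≤ B := by positivity
  have hL : ∀ᶠ k in atTop, ‖covOp H (μ.map (x (k + 1))) - covOp H (μ.map (x k))‖ ≤
      B * (a k * lam k ^ 2) := by
    filter_upwards [hC] with k hk
    have h0 : 0 ≤ a k * lam k ^ 2 := mul_nonneg (ha k).le (sq_nonneg _)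
    rw [hB, mul_assoc]
    refine norm_covOp_sub_le hH hτ.le hKs hφ hκ0.le hκ (mul_nonneg C.2 h0) (hk.trans_eq ?_)
    rw [ENNReal.ofReal_mul C.coe_nonneg]
    simp
  have hwlim : Tendsto (fun k => ‖w k‖) atTop (𝓝 0) := by
    refine tendsto_norm_regularized hφ hκ0 hκ hh hγ
      (fun k => mul_nonneg hB0 (mul_nonneg (ha k).le (sq_nonneg _))) ?_ ?_ hL hl
      hgain.tendsto_lam hw
    · intro i j hij
      have h1 := hgain.a_antitone hij
      have h2 := pow_le_pow_left₀ (hl j).le (hgain.lam_antitone hij) 2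
      exact mul_le_mul_of_nonneg_left (mul_le_mul h1 h2 (sq_nonneg _) (ha i).le) hB0
    · simpa using (hgain.tendsto_a.mul (hgain.tendsto_lam.pow 2)).const_mul B
  -- so does the regularization path
  set ε : ℕ → ℝ := fun k =>
    B * ‖w (k + 1)‖ + 2 * ‖fstar‖ * (1 / ((k : ℝ) + 1) / (a k * lam k)) with hε
  have hεlim : Tendsto ε atTop (𝓝 0) := by
    simpa [hε] using ((hwlim.comp (tendsto_add_atTop_nat 1)).const_mul B).add
      (hgain.tendsto_inv_div_mul.const_mul (2 * ‖fstar‖))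
  have hwε : ∀ᶠ k in atTop, ‖w (k + 1) - w k‖ ≤ a k * lam k * ε k := by
    filter_upwards [hL] with k hk
    have h1 := (hco k).norm_regularized_sub_le hκ0 (hw k) (hw (k + 1))
    rw [abs_of_nonneg (sub_nonneg.2 (hgain.lam_antitone k.le_succ))] at h1
    refine le_of_mul_le_mul_left (h1.trans ((add_le_add
      (mul_le_mul_of_nonneg_right hk (norm_nonneg _)) (mul_le_mul (hgain.lam_sub_le k)
        (add_le_add (hwf (k + 1)) le_rfl) (by positivity)
        (mul_nonneg (by positivity) (hl k).le))).trans_eq ?_)) (hl k)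
    have := (ha k).ne'
    have := (hl k).ne'
    simp only [hε]
    field_simp
    ring
  -- mean square convergence to the regularization path
  have hb : Tendsto (fun k => ∫ ω, ‖estimate a lam x y f₀ k ω - (fstar + w k)‖ ^ 2 ∂μ) atTop
      (𝓝 0) := by
    -- The recursion contracts at rate `a_k λ_k / 2`.
    have hsum := hgain.tendsto_sum_mul.atTop_div_const (two_pos : (0 : ℝ) < 2)
    simp_rw [Finset.sum_div] at hsum
    have hεM : Tendsto (fun k => 10 * ε k ^ 2 +
        8 * (2 * κ * β + 8 * κ ^ 2 * ‖fstar‖ ^ 2) * (a k / lam k)) atTop (𝓝 0) := by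
      simpa using ((hεlim.pow 2).const_mul 10).add (hgain.tendsto_a_div_lam.const_mul
        (8 * (2 * κ * β + 8 * κ ^ 2 * ‖fstar‖ ^ 2)))
    have hal : ∀ᶠ k in atTop, a k ≤ 1 := hgain.tendsto_a.eventually (ge_mem_nhds one_pos)
    refine tendsto_zero_of_le_one_sub_mul_add (fun k => integral_nonneg fun ω => sq_nonneg _)
      ?_ hsum hεM ?_
    · filter_upwards [hal] with k hk
      have h1 := mul_pos (ha k) (hl k)
      have h2 := mul_le_one₀ hk (hl k).le (hgain.lam_le_one k)
      constructor <;> linarith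
    · have hac : ∀ᶠ k in atTop, a k * (κ + 2) ≤ 2 :=
        (by simpa using hgain.tendsto_a.mul_const (κ + 2) :
          Tendsto (fun k => a k * (κ + 2)) atTop (𝓝 0)).eventually (ge_mem_nhds two_pos)
      have hacl : ∀ᶠ k in atTop, a k / lam k * (κ + 1) ^ 2 ≤ 1 / 4 :=
        (by simpa using hgain.tendsto_a_div_lam.mul_const ((κ + 1) ^ 2) :
          Tendsto (fun k => a k / lam k * (κ + 1) ^ 2) atTop (𝓝 0)).eventually
            (ge_mem_nhds (by norm_num))
      filter_upwards [hal, hac, hacl, hwε] with k h1 h2 h3 h4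
      exact integral_norm_estimate_sub_sq_le hφ hκ0 hκ hx hy hβ f₀ hmodel hindep (hvK k) (ha k)
        (hl k) (hgain.lam_le_one k) h1 h2 h3 (hw k) h4
  have hmain : Tendsto (fun k => ∫ ω, ‖estimate a lam x y f₀ k ω - fstar‖ ^ 2 ∂μ) atTop
      (𝓝 0) := by
    have hlim : Tendsto (fun k => 2 * ∫ ω, ‖estimate a lam x y f₀ k ω - (fstar + w k)‖ ^ 2 ∂μ +
        2 * ‖w k‖ ^ 2) atTop (𝓝 0) := by
      simpa using (hb.const_mul 2).add ((hwlim.pow 2).const_mul 2)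
    refine squeeze_zero (fun k => integral_nonneg fun ω => sq_nonneg _) (fun k => ?_) hlim
    have h1 := integral_norm_add_const_sq_le ((hest k).sub (memLp_const (fstar + w k))) (w k)
      (η := 1) one_pos
    simp only [Pi.sub_apply, fun z : H => (by abel : z - (fstar + w k) + w k = z - fstar)] at h1
    norm_num at h1
    exact h1
  have he : (fun k => eLpNorm (fun ω => estimate a lam x y f₀ k ω - fstar) 2 μ ^ 2) =
      fun k => ENNReal.ofReal (∫ ω, ‖estimate a lam x y f₀ k ω - fstar‖ ^ 2 ∂μ) :=
    funext fun k => eLpNorm_two_sq_eq_ofReal_integral ((hest k).sub (memLp_const fstar))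
  rw [he]
  simpa using ENNReal.tendsto_ofReal hmain
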